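/- Setting. A $C^*$-probability space is a unital $C^*$-algebra $\mathcal A$ with a state $\varphi$. The distribution $\mu_{(u,v)}$ of a pair of commuting unitaries $u,v\in\mathcal A$ is the Borel probability measure on $\mathbb T^2$ with $\int f\,d\mu_{(u,v)}=\varphi(f(u,v))$ for all $f\in C(\mathbb T^2)$. Let $\mathrm m=\frac{d\theta}{2\pi}\otimes\frac{d\theta}{2\pi}$ be the uniform measure on $\mathbb T^2$. For Borel probability measures $\mu_1,\mu_2$ on $\mathbb T^2$ let $H_i=L^2(\mu_i)$, let $\xi_i\in H_i$ be the constant function $1$, and put $H_i^\circ=H_i\ominus\mathbb C\xi_i$. Let $(H,\xi)$ be the Hilbert space free product of $(H_1,\xi_1)$ and $(H_2,\xi_2)$, that is, $H=\mathbb C\xi\oplus\bigoplus_{n\ge1}\bigoplus_{i_1\ne i_2\ne\cdots\ne i_n}H_{i_1}^\circ\otimes\cdots\otimes H_{i_n}^\circ$, and let $\varphi_\xi(T)=\langle T\xi,\xi\rangle$ on $B(H)$. Let $H(\ell,i)$ (resp. $H(r,i)$) be the sum of $\mathbb C\xi$ and of the summands with $i_1\ne i$ (resp. $i_n\ne i$),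 let $V_i:H_i\otimes H(\ell,i)\to H$ and $W_i:H(r,i)\otimes H_i\to H$ be the canonical unitaries, and let $S_i,T_i\in B(H_i)$ be the multiplications by the first and the second coordinate. The pairs $(u_i,v_i)$, $i=1,2$, where $u_i=V_i(S_i\otimes I)V_i^{-1}$ and $v_i=W_i(I\otimes T_i)W_i^{-1}$, are the canonical bi-free pairs with distributions $\mu_1,\mu_2$ in $(B(H),\varphi_\xi)$, and the bi-free convolution $\mu_1\boxtimes\boxtimes\mu_2$ is the distribution of $(u_1u_2,v_1v_2)$. Proposition 2.3. (1) Let $\mu_1,\mu_2$ be Borel probability measures on $\mathbb T^2$ with canonical bi-free pairs $(u_1,v_1)$, $(u_2,v_2)$ as above. If $\varphi_\xi(u_i)=0=\varphi_\xi(v_i)$ for $i=1,2$, then $$\mu_1\boxtimes\boxtimes\mu_2=\mathrm m\quad\Longleftrightarrow\quad \varphi_\xi(u_1v_1)=0\ \text{ or }\ \varphi_\xi(u_2v_2)=0 .$$ (2) More generally, let $(u_1,v_1)$ and $(u_2,v_2)$ be any pairs of commuting unitaries in a $C^*$-probability space $(\mathcal A,\varphi)$ (for example, bi-free ones) with $\varphi(u_i)=0=\varphi(v_i)$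 for $i=1,2$. Then $\mu_{(u_1,v_1)}\boxtimes\boxtimes\mu_{(u_2,v_2)}=\mathrm m$ if and only if $\varphi(u_1v_1)=0$ or $\varphi(u_2v_2)=0$. (3) In particular, if $u,v$ are commuting unitaries in a $C^*$-probability space $(\mathcal A,\varphi)$ with $\varphi(u)=0=\varphi(v)$, then $\mu_{(u,v)}\boxtimes\boxtimes\mathrm m=\mathrm m=\mathrm m\boxtimes\boxtimes\mu_{(u,v)}$. -/

import Mathlib

open MeasureTheory
open scoped ComplexOrder InnerProductSpace TensorProduct ENNReal

noncomputable section

namespace BiFree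

instance : MeasurableSpace Circle := borel Circle
instance : BorelSpace Circle := ⟨rfl⟩

/-- The two-dimensional torus `𝕋²`. -/
abbrev Torus : Type := Circle × Circle

/-- A state on a unital C⋆-algebra: a positive linear functional of value `1` at the identity.
A pair of a unital C⋆-algebra and a state on it is a C⋆-probability space. -/
structure State (A : Type*) [CStarAlgebra A] where
  toLinearMap : A →ₗ[ℂ] ℂ
  map_nonneg : ∀ a, 0 ≤ toLinearMap (star a * a)
  map_one : toLinearMap 1 = 1

instance {A : Type*} [CStarAlgebra A] : CoeFun (State A) (fun _ => A → ℂ) :=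
  ⟨fun φ => φ.toLinearMap⟩

lemma character_mem_unitSphere {B : Type*} [CommCStarAlgebra B]
    (χ : WeakDual.characterSpace ℂ B) (u : unitary B) :
    χ (u : B) ∈ Submonoid.unitSphere ℂ := by
  have h := congrArg χ (Unitary.coe_star_mul_self u)
  rw [map_mul, map_star, map_one, RCLike.star_def, Complex.conj_mul'] at h
  have h2 : ‖χ (u : B)‖ ^ 2 = 1 := by exact_mod_cast h
  exact mem_sphere_zero_iff_norm.2 (by nlinarith [norm_nonneg (χ (u : B))])

/-- The point `χ ↦ (χ u, χ v)` of the torus attached to a character `χ` of a commutative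
C⋆-algebra and two unitaries `u`, `v`. -/
def gelfandPoint {B : Type*} [CommCStarAlgebra B] (u v : unitary B) :
    C(WeakDual.characterSpace ℂ B, Torus) where
  toFun χ := (⟨χ u, character_mem_unitSphere χ u⟩, ⟨χ v, character_mem_unitSphere χ v⟩)
  continuous_toFun := by
    refine Continuous.prodMk ?_ ?_
    · refine Continuous.subtype_mk (p := (· ∈ Submonoid.unitSphere ℂ)) ?_ _
      exact (WeakDual.gelfandTransform ℂ B (u : B)).continuous
    · refine Continuous.subtype_mk (p := (· ∈ Submonoid.unitSphere ℂ)) ?_ _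
      exact (WeakDual.gelfandTransform ℂ B (v : B)).continuous

/-- The continuous functional calculus `f ↦ f(u, v)` on the torus for two unitaries of a
commutative C⋆-algebra: the composition of `f ↦ (χ ↦ f (χ u, χ v))` with the inverse of the
Gelfand isomorphism. -/
def commFunctionalCalculus {B : Type*} [CommCStarAlgebra B] (u v : unitary B) :
    C(Torus, ℂ) →⋆ₐ[ℂ] B :=
  ((gelfandStarTransform B).symm : C(WeakDual.characterSpace ℂ B, ℂ) →⋆ₐ[ℂ] B).comp
    (ContinuousMap.compStarAlgHom' ℂ ℂ (gelfandPoint u v))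

section Distribution

variable {A : Type*} [CStarAlgebra A]

/-- The C⋆-subalgebra generated by the identity, `u` and `v`. -/
abbrev generatedAlgebra (u v : unitary A) : StarSubalgebra ℂ A :=
  (StarAlgebra.adjoin ℂ {(u : A), (v : A)}).topologicalClosure

lemma isMulCommutative_adjoin {u v : unitary A} (h : Commute u v) :
    IsMulCommutative (StarAlgebra.adjoin ℂ {(u : A), (v : A)}) := by
  have huv : Commute (u : A) (v : A) := congrArg Subtype.val h.eq
  have huv' : Commute (u : A) (star (v : A)) :=
    congrArg Subtype.val (h.inv_right).eq
  have hvu' : Commute (v : A) (star (u : A)) :=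
    congrArg Subtype.val (h.symm.inv_right).eq
  have hu : (u : A) * star (u : A) = star (u : A) * u := by simp
  have hv : (v : A) * star (v : A) = star (v : A) * v := by simp
  refine StarAlgebra.isMulCommutative_adjoin ℂ ?_ ?_
  · rintro x (rfl | rfl) y (rfl | rfl)
    exacts [rfl, huv, huv.symm, rfl]
  · rintro x (rfl | rfl) y (rfl | rfl)
    exacts [hu, huv', hvu', hv]

/-- The C⋆-algebra generated by two commuting unitaries is commutative. -/
abbrev generatedCommCStarAlgebra {u v : unitary A} (h : Commute u v) :
    CommCStarAlgebra (generatedAlgebra u v) :=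
  have := isMulCommutative_adjoin h
  have _hS : IsClosed (generatedAlgebra u v : Set A) :=
    (StarAlgebra.adjoin ℂ {(u : A), (v : A)}).isClosed_topologicalClosure
  { (inferInstance : CStarAlgebra (generatedAlgebra u v)),
    (StarAlgebra.adjoin ℂ {(u : A), (v : A)}).commRingTopologicalClosure
      (fun x y => mul_comm' x y) with }


/-- The continuous functional calculus `f ↦ f(u, v)` for two commuting unitaries. -/
def functionalCalculus {u v : unitary A} (h : Commute u v) : C(Torus, ℂ) →⋆ₐ[ℂ] A :=
  letI := generatedCommCStarAlgebra h
  let B := generatedAlgebra u v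
  have hu : (u : A) ∈ B := StarSubalgebra.le_topologicalClosure _
    (StarAlgebra.subset_adjoin ℂ _ (by simp))
  have hv : (v : A) ∈ B := StarSubalgebra.le_topologicalClosure _
    (StarAlgebra.subset_adjoin ℂ _ (by simp))
  let u' : unitary B := ⟨⟨u, hu⟩, by
    constructor <;> exact Subtype.ext (by simp)⟩
  let v' : unitary B := ⟨⟨v, hv⟩, by
    constructor <;> exact Subtype.ext (by simp)⟩
  B.subtype.comp (commFunctionalCalculus u' v')

/-- The positive functional `f ↦ φ(f(u, v))` on the continuous real functions on the torus. -/
def lawFunctional (φ : State A) {u v : unitary A} (h : Commute u v) :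
    CompactlySupportedContinuousMap Torus ℝ →ₚ[ℝ] ℝ :=
  PositiveLinearMap.mk₀
    { toFun := fun f => (φ (functionalCalculus h
        (ContinuousMap.comp ⟨Complex.ofReal, Complex.continuous_ofReal⟩ f.toContinuousMap))).re
      map_add' := fun f g => by
        rw [← Complex.add_re, ← map_add, ← map_add]
        congr 4
        ext x
        simp
      map_smul' := fun c f => by
        rw [RingHom.id_apply, smul_eq_mul, ← Complex.re_ofReal_mul, ← smul_eq_mul, ← map_smul,
          ← map_smul]
        congr 4
        ext x
        simp }
    (fun f hf => by
      let g : C(Torus, ℂ) := ⟨fun x => (Real.sqrt (f x) : ℂ), by fun_prop⟩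
      have hg : ContinuousMap.comp ⟨Complex.ofReal, Complex.continuous_ofReal⟩ f.toContinuousMap
          = star g * g := by
        ext x
        have := Real.mul_self_sqrt (hf x)
        simp only [ContinuousMap.comp_apply, ContinuousMap.coe_mk, ContinuousMap.mul_apply,
          ContinuousMap.star_apply, RCLike.star_def, Complex.conj_ofReal, g]
        exact_mod_cast this.symm
      change 0 ≤ (φ (functionalCalculus h _)).re
      rw [hg, map_mul, map_star]
      exact (Complex.le_def.1 (φ.map_nonneg _)).1)

lemma isProbabilityMeasure_rieszMeasure (φ : State A) {u v : unitary A} (h : Commute u v) :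
    IsProbabilityMeasure (RealRMK.rieszMeasure (lawFunctional φ h)) := by
  have h1 := RealRMK.integral_rieszMeasure (lawFunctional φ h)
    (CompactlySupportedContinuousMap.continuousMapEquiv (1 : C(Torus, ℝ)))
  have h2 : lawFunctional φ h
      (CompactlySupportedContinuousMap.continuousMapEquiv (1 : C(Torus, ℝ))) = 1 := by
    change (φ (functionalCalculus h _)).re = 1
    have : (ContinuousMap.comp ⟨Complex.ofReal, Complex.continuous_ofReal⟩
        (CompactlySupportedContinuousMap.continuousMapEquiv (1 : C(Torus, ℝ))).toContinuousMap
          : C(Torus, ℂ)) = 1 := by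
      ext x
      simp
    rw [this, map_one, φ.map_one, Complex.one_re]
  rw [h2] at h1
  have h3 : (RealRMK.rieszMeasure (lawFunctional φ h)).real Set.univ = 1 := by
    simpa using h1
  exact ⟨by rwa [Measure.real, ENNReal.toReal_eq_one_iff] at h3⟩

/-- The probability measure `μ` on the torus with `∫ f dμ = φ(f(u, v))` for all continuous `f`,
obtained from the functional calculus by the Riesz–Markov–Kakutani theorem. -/
def commutingLaw (φ : State A) {u v : unitary A} (h : Commute u v) : ProbabilityMeasure Torus :=
  ⟨RealRMK.rieszMeasure (lawFunctional φ h), isProbabilityMeasure_rieszMeasure φ h⟩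

open scoped Classical in
/-- The distribution of a pair of commuting unitaries `u`, `v` of a C⋆-probability space. For
unitaries that do not commute there is no such notion, and the value `δ_(1,1)` is irrelevant. -/
def distribution (φ : State A) (u v : unitary A) : ProbabilityMeasure Torus :=
  if h : Commute u v then commutingLaw φ h else diracProba 1

end Distribution

/-- The normalized arc length measure `dθ/2π` on the circle. -/
def arcLength : Measure Circle :=
  (ENNReal.ofReal (2 * Real.pi))⁻¹ •
    (volume.restrict (Set.Ioc (-Real.pi) Real.pi)).map Circle.exp

instance : IsProbabilityMeasure arcLength := by
  refine ⟨?_⟩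
  rw [arcLength, Measure.smul_apply, Measure.map_apply (by fun_prop) MeasurableSet.univ]
  simp only [Set.preimage_univ, Measure.restrict_apply_univ, Real.volume_Ioc, smul_eq_mul]
  rw [show Real.pi - -Real.pi = 2 * Real.pi by ring]
  exact ENNReal.inv_mul_cancel (by simp [Real.pi_pos]) ENNReal.ofReal_ne_top

/-- The uniform measure `dθ/2π ⊗ dθ/2π` on the torus. -/
def uniform : ProbabilityMeasure Torus := ⟨arcLength.prod arcLength, inferInstance⟩

/-- A Hilbert space with a distinguished unit vector. -/
structure PointedHilbert where
  carrier : Type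
  [normedAddCommGroup : NormedAddCommGroup carrier]
  [innerProductSpace : InnerProductSpace ℂ carrier]
  [completeSpace : CompleteSpace carrier]
  vec : carrier
  norm_vec : ‖vec‖ = 1

attribute [instance] PointedHilbert.normedAddCommGroup PointedHilbert.innerProductSpace
  PointedHilbert.completeSpace

/-- The orthogonal complement of the distinguished vector. -/
def PointedHilbert.Circ (E : PointedHilbert) : Type := ((ℂ ∙ E.vec)ᗮ : Submodule ℂ E.carrier)

instance (E : PointedHilbert) : NormedAddCommGroup E.Circ :=
  inferInstanceAs (NormedAddCommGroup ((ℂ ∙ E.vec)ᗮ : Submodule ℂ E.carrier))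

instance (E : PointedHilbert) : InnerProductSpace ℂ E.Circ :=
  inferInstanceAs (InnerProductSpace ℂ ((ℂ ∙ E.vec)ᗮ : Submodule ℂ E.carrier))

/-- The inclusion of the orthogonal complement of the distinguished vector. -/
def PointedHilbert.incl (E : PointedHilbert) : E.Circ →ₗᵢ[ℂ] E.carrier :=
  ((ℂ ∙ E.vec)ᗮ : Submodule ℂ E.carrier).subtypeₗᵢ

/-- The orthogonal projection onto the complement of the distinguished vector. -/
def PointedHilbert.proj (E : PointedHilbert) : E.carrier →L[ℂ] E.Circ :=
  ((ℂ ∙ E.vec)ᗮ : Submodule ℂ E.carrier).orthogonalProjectionOnto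

lemma PointedHilbert.incl_proj (E : PointedHilbert) (h : E.carrier) :
    E.incl (E.proj h) = h - ⟪E.vec, h⟫_ℂ • E.vec := by
  change (((ℂ ∙ E.vec)ᗮ.orthogonalProjectionOnto h : (ℂ ∙ E.vec)ᗮ) : E.carrier) = _
  rw [Submodule.orthogonalProjectionOnto_orthogonal]
  change h - (ℂ ∙ E.vec).starProjection h = _
  rw [Submodule.starProjection_unit_singleton ℂ E.norm_vec]

lemma PointedHilbert.inner_vec_incl (E : PointedHilbert) (h : E.Circ) :
    ⟪E.vec, E.incl h⟫_ℂ = 0 :=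
  Submodule.mem_orthogonal_singleton_iff_inner_right.1 h.2

lemma PointedHilbert.proj_incl (E : PointedHilbert) (h : E.Circ) : E.proj (E.incl h) = h := by
  apply E.incl.injective
  rw [E.incl_proj, E.inner_vec_incl]
  simp

lemma PointedHilbert.proj_vec (E : PointedHilbert) : E.proj E.vec = 0 := by
  apply E.incl.injective
  rw [E.incl_proj, inner_self_eq_norm_sq_to_K, E.norm_vec]
  simp

/-- A bundled complex inner product space, not necessarily complete. -/
structure PreHilbert where
  carrier : Type
  [normedAddCommGroup : NormedAddCommGroup carrier]
  [innerProductSpace : InnerProductSpace ℂ carrier]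

attribute [instance] PreHilbert.normedAddCommGroup PreHilbert.innerProductSpace

section Splitting

/-- `h ⊗ x ↦ ⟨ξ, h⟩ x`. -/
def vacPart (E : PointedHilbert) (X : Type) [NormedAddCommGroup X] [InnerProductSpace ℂ X] :
    E.carrier ⊗[ℂ] X →L[ℂ] X :=
  ((TensorProduct.lidIsometry ℂ X).toContinuousLinearEquiv : ℂ ⊗[ℂ] X →L[ℂ] X).comp
    (ContinuousLinearMap.rTensor X (innerSL ℂ E.vec))

/-- `h ⊗ x ↦ (h - ⟨ξ, h⟩ ξ) ⊗ x`. -/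
def circPart (E : PointedHilbert) (X : Type) [NormedAddCommGroup X] [InnerProductSpace ℂ X] :
    E.carrier ⊗[ℂ] X →L[ℂ] E.Circ ⊗[ℂ] X :=
  ContinuousLinearMap.rTensor X E.proj

lemma inner_vacPart_add_inner_circPart (E : PointedHilbert) (X : Type) [NormedAddCommGroup X]
    [InnerProductSpace ℂ X] (z z' : E.carrier ⊗[ℂ] X) :
    ⟪vacPart E X z, vacPart E X z'⟫_ℂ + ⟪circPart E X z, circPart E X z'⟫_ℂ = ⟪z, z'⟫_ℂ := by
  induction z using TensorProduct.induction_on with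
  | zero => simp
  | add z₁ z₂ h₁ h₂ =>
    simp only [map_add, inner_add_left]
    rw [← h₁, ← h₂]; ring
  | tmul h x =>
    induction z' using TensorProduct.induction_on with
    | zero => simp
    | add z₁ z₂ h₁ h₂ =>
      simp only [map_add, inner_add_right]
      rw [← h₁, ← h₂]; ring
    | tmul h' x' =>
      have key : ⟪h, h'⟫_ℂ = ⟪h, E.vec⟫_ℂ * ⟪E.vec, h'⟫_ℂ
          + ⟪E.proj h, E.proj h'⟫_ℂ := by
        rw [← E.incl.inner_map_map, E.incl_proj, E.incl_proj]
        simp only [inner_sub_left, inner_sub_right, inner_smul_left, inner_smul_right,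
          inner_self_eq_norm_sq_to_K, E.norm_vec, inner_conj_symm]
        simp
      simp [vacPart, circPart, key]
      ring

variable {W : Type} (E : PointedHilbert) (G : W → PreHilbert)

/-- The Hilbert space direct sum of the completions of a family of inner product spaces. -/
abbrev HilbertSum : Type := lp (fun w : W => UniformSpace.Completion (G w).carrier) 2

/-- A splitting of the index set of a family `G` into "base" and "extended" indices, in bijection
with each other, together with identifications `E° ⊗ G (base k) ≃ G (ext k)`. It identifies
`⨁ G` with `E ⊗ (⨁ₖ G (base k))`, where `E = ℂξ ⊕ E°`. -/
structure Splitting where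
  K : Type
  base : K → W
  ext : K → W
  base_injective : Function.Injective base
  ext_injective : Function.Injective ext
  base_ne_ext : ∀ k l, base k ≠ ext l
  cover : ∀ w, (∃ k, base k = w) ∨ ∃ k, ext k = w
  iso : ∀ k, E.Circ ⊗[ℂ] (G (base k)).carrier ≃ₗᵢ[ℂ] (G (ext k)).carrier

variable {E G}

namespace Splitting

variable (σ : Splitting E G) (k : σ.K)

/-- The component of the embedding at the base index: `h ⊗ x ↦ ⟨ξ, h⟩ x`. -/
def vacC : UniformSpace.Completion (E.carrier ⊗[ℂ] (G (σ.base k)).carrier) →L[ℂ]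
    UniformSpace.Completion (G (σ.base k)).carrier :=
  (vacPart E (G (σ.base k)).carrier).completion

/-- The component of the embedding at the extended index: `h ⊗ x ↦ (h - ⟨ξ, h⟩ ξ) ⊗ x`. -/
def circC : UniformSpace.Completion (E.carrier ⊗[ℂ] (G (σ.base k)).carrier) →L[ℂ]
    UniformSpace.Completion (G (σ.ext k)).carrier :=
  (((σ.iso k).toContinuousLinearEquiv :
      E.Circ ⊗[ℂ] (G (σ.base k)).carrier →L[ℂ] (G (σ.ext k)).carrier).comp
    (circPart E (G (σ.base k)).carrier)).completion

lemma norm_vacC_sq_add_norm_circC_sq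
    (z : UniformSpace.Completion (E.carrier ⊗[ℂ] (G (σ.base k)).carrier)) :
    ‖σ.vacC k z‖ ^ 2 + ‖σ.circC k z‖ ^ 2 = ‖z‖ ^ 2 := by
  induction z using UniformSpace.Completion.induction_on with
  | hp => exact isClosed_eq (by fun_prop) (by fun_prop)
  | ih z =>
    have h1 : ‖σ.vacC k z‖ = ‖vacPart E (G (σ.base k)).carrier z‖ := by
      rw [vacC, ContinuousLinearMap.completion_apply_coe, UniformSpace.Completion.norm_coe]
    have h2 : ‖σ.circC k z‖ = ‖circPart E (G (σ.base k)).carrier z‖ := by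
      rw [circC, ContinuousLinearMap.completion_apply_coe, UniformSpace.Completion.norm_coe]
      exact (σ.iso k).norm_map _
    have h3 := congrArg Complex.re
      (inner_vacPart_add_inner_circPart E (G (σ.base k)).carrier z z)
    rw [Complex.add_re] at h3
    rw [h1, h2, UniformSpace.Completion.norm_coe]
    have h4 := inner_self_eq_norm_sq (𝕜 := ℂ) (vacPart E (G (σ.base k)).carrier z)
    have h5 := inner_self_eq_norm_sq (𝕜 := ℂ) (circPart E (G (σ.base k)).carrier z)
    have h6 := inner_self_eq_norm_sq (𝕜 := ℂ) z
    rw [RCLike.re_eq_complex_re] at h4 h5 h6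
    rw [← h4, ← h5, ← h6, h3]

open scoped Classical in
lemma norm_single_add_single_sq {a b : W} (hab : a ≠ b)
    (x : UniformSpace.Completion (G a).carrier) (y : UniformSpace.Completion (G b).carrier) :
    ‖(lp.single 2 a x + lp.single 2 b y : HilbertSum G)‖ ^ 2 = ‖x‖ ^ 2 + ‖y‖ ^ 2 := by
  have h : ⟪(lp.single 2 a x : HilbertSum G), lp.single 2 b y⟫_ℂ = 0 := by
    rw [lp.inner_single_left, lp.single_apply_ne _ _ _ hab, inner_zero_right]
  have h2 := norm_add_sq_eq_norm_sq_add_norm_sq_of_inner_eq_zero _ _ h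
  rw [lp.norm_single (by simp), lp.norm_single (by simp)] at h2
  simpa only [sq] using h2

open scoped Classical in
/-- The isometric embedding `h ⊗ x ↦ ⟨ξ, h⟩ x + (h - ⟨ξ, h⟩ ξ) ⊗ x` of the completed tensor
product `E ⊗ G (base k)` into `⨁ G`. -/
def embed : UniformSpace.Completion (E.carrier ⊗[ℂ] (G (σ.base k)).carrier) →ₗᵢ[ℂ]
    HilbertSum G where
  toLinearMap :=
    (lp.lsingle (𝕜 := ℂ) 2 (σ.base k)).comp (σ.vacC k).toLinearMap
      + (lp.lsingle (𝕜 := ℂ) 2 (σ.ext k)).comp (σ.circC k).toLinearMap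
  norm_map' z := by
    have h : ‖(lp.single 2 (σ.base k) (σ.vacC k z) + lp.single 2 (σ.ext k) (σ.circC k z) :
        HilbertSum G)‖ ^ 2 = ‖z‖ ^ 2 := by
      rw [norm_single_add_single_sq (σ.base_ne_ext k k), norm_vacC_sq_add_norm_circC_sq]
    exact (sq_eq_sq₀ (norm_nonneg _) (norm_nonneg _)).1 h

open scoped Classical in
lemma embed_apply (z : UniformSpace.Completion (E.carrier ⊗[ℂ] (G (σ.base k)).carrier)) :
    σ.embed k z = lp.single 2 (σ.base k) (σ.vacC k z) + lp.single 2 (σ.ext k) (σ.circC k z) :=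
  rfl

lemma orthogonalFamily_embed : OrthogonalFamily ℂ _ σ.embed := by
  intro k l hkl z z'
  classical
  rw [embed_apply, embed_apply, inner_add_left, inner_add_right, inner_add_right]
  simp only [lp.inner_single_left]
  rw [lp.single_apply_ne _ _ _ (σ.base_injective.ne hkl),
    lp.single_apply_ne _ _ _ (σ.base_ne_ext k l),
    lp.single_apply_ne _ _ _ (σ.base_ne_ext l k).symm,
    lp.single_apply_ne _ _ _ (σ.ext_injective.ne hkl)]
  simp

open scoped Classical in
lemma single_base_mem_range (x : UniformSpace.Completion (G (σ.base k)).carrier) :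
    (lp.single 2 (σ.base k) x : HilbertSum G) ∈ (σ.embed k).toLinearMap.range := by
  let j : (G (σ.base k)).carrier →L[ℂ] E.carrier ⊗[ℂ] (G (σ.base k)).carrier :=
    TensorProduct.mkL ℂ E.carrier (G (σ.base k)).carrier E.vec
  have hv : ∀ x, σ.vacC k (j.completion x) = x := by
    intro x
    induction x using UniformSpace.Completion.induction_on with
    | hp => exact isClosed_eq (by fun_prop) (by fun_prop)
    | ih x =>
      rw [ContinuousLinearMap.completion_apply_coe, vacC,
        ContinuousLinearMap.completion_apply_coe]
      simp [j, vacPart, inner_self_eq_norm_sq_to_K, E.norm_vec]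
  have hc : ∀ x, σ.circC k (j.completion x) = 0 := by
    intro x
    induction x using UniformSpace.Completion.induction_on with
    | hp => exact isClosed_eq (by fun_prop) (by fun_prop)
    | ih x =>
      rw [ContinuousLinearMap.completion_apply_coe, circC,
        ContinuousLinearMap.completion_apply_coe]
      simp [j, circPart, E.proj_vec]
  refine ⟨j.completion x, ?_⟩
  change σ.embed k (j.completion x) = _
  rw [embed_apply, hv, hc, lp.single_zero, add_zero]

open scoped Classical in
lemma single_ext_mem_range (x : UniformSpace.Completion (G (σ.ext k)).carrier) :
    (lp.single 2 (σ.ext k) x : HilbertSum G) ∈ (σ.embed k).toLinearMap.range := by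
  let j : (G (σ.ext k)).carrier →L[ℂ] E.carrier ⊗[ℂ] (G (σ.base k)).carrier :=
    (E.incl.toContinuousLinearMap.rTensor (G (σ.base k)).carrier).comp
      ((σ.iso k).symm.toContinuousLinearEquiv :
        (G (σ.ext k)).carrier →L[ℂ] E.Circ ⊗[ℂ] (G (σ.base k)).carrier)
  have hv0 : ∀ y : E.Circ ⊗[ℂ] (G (σ.base k)).carrier, vacPart E (G (σ.base k)).carrier
      (E.incl.toContinuousLinearMap.rTensor (G (σ.base k)).carrier y) = 0 := by
    intro y
    induction y using TensorProduct.induction_on with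
    | zero => simp
    | add y₁ y₂ h₁ h₂ => rw [map_add, map_add, h₁, h₂, add_zero]
    | tmul h x => simp [vacPart, E.inner_vec_incl]
  have hc0 : ∀ y : E.Circ ⊗[ℂ] (G (σ.base k)).carrier, circPart E (G (σ.base k)).carrier
      (E.incl.toContinuousLinearMap.rTensor (G (σ.base k)).carrier y) = y := by
    intro y
    induction y using TensorProduct.induction_on with
    | zero => simp
    | add y₁ y₂ h₁ h₂ => rw [map_add, map_add, h₁, h₂]
    | tmul h x => simp [circPart, E.proj_incl]
  have hv : ∀ x, σ.vacC k (j.completion x) = 0 := by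
    intro x
    induction x using UniformSpace.Completion.induction_on with
    | hp => exact isClosed_eq (by fun_prop) (by fun_prop)
    | ih x =>
      rw [ContinuousLinearMap.completion_apply_coe, vacC,
        ContinuousLinearMap.completion_apply_coe]
      change ((vacPart E _ (E.incl.toContinuousLinearMap.rTensor _ ((σ.iso k).symm x)) :
        (G (σ.base k)).carrier) : UniformSpace.Completion (G (σ.base k)).carrier) = 0
      rw [hv0, UniformSpace.Completion.coe_zero]
  have hc : ∀ x, σ.circC k (j.completion x) = x := by
    intro x
    induction x using UniformSpace.Completion.induction_on with
    | hp => exact isClosed_eq (by fun_prop) (by fun_prop)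
    | ih x =>
      rw [ContinuousLinearMap.completion_apply_coe, circC,
        ContinuousLinearMap.completion_apply_coe]
      change ((σ.iso k (circPart E _ (E.incl.toContinuousLinearMap.rTensor _
        ((σ.iso k).symm x))) : (G (σ.ext k)).carrier) :
          UniformSpace.Completion (G (σ.ext k)).carrier) = x
      rw [hc0, LinearIsometryEquiv.apply_symm_apply]
  refine ⟨j.completion x, ?_⟩
  change σ.embed k (j.completion x) = _
  rw [embed_apply, hv, hc, lp.single_zero, zero_add]

lemma isHilbertSum_embed : IsHilbertSum ℂ _ σ.embed := by
  classical
  refine IsHilbertSum.mk σ.orthogonalFamily_embed ?_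
  intro f _
  have hf := lp.hasSum_single (p := 2) (by simp) f
  refine (Submodule.isClosed_topologicalClosure _).mem_of_tendsto hf
    (Filter.Eventually.of_forall fun s => Submodule.sum_mem _ fun w _ => ?_)
  refine Submodule.le_topologicalClosure _ ?_
  rcases σ.cover w with ⟨k, rfl⟩ | ⟨k, rfl⟩
  · exact Submodule.mem_iSup_of_mem k (σ.single_base_mem_range k _)
  · exact Submodule.mem_iSup_of_mem k (σ.single_ext_mem_range k _)

/-- The unitary identification of `⨁ G` with `E ⊗ (⨁ₖ G (base k)) = ⨁ₖ E ⊗ G (base k)`. -/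
def equiv : HilbertSum G ≃ₗᵢ[ℂ]
    lp (fun k => UniformSpace.Completion (E.carrier ⊗[ℂ] (G (σ.base k)).carrier)) 2 :=
  σ.isHilbertSum_embed.linearIsometryEquiv

end Splitting

/-- The extension of a unitary to the completions. -/
def completionUnitary {X : Type} [NormedAddCommGroup X] [InnerProductSpace ℂ X]
    (U : X ≃ₗᵢ[ℂ] X) : UniformSpace.Completion X ≃ₗᵢ[ℂ] UniformSpace.Completion X :=
  U.toLinearEquiv.extendOfIsometry UniformSpace.Completion.toComplₗᵢ.toLinearMap
    UniformSpace.Completion.toComplₗᵢ.toLinearMap UniformSpace.Completion.denseRange_coe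
    UniformSpace.Completion.denseRange_coe (fun x => by simp)

/-- The direct sum of a family of unitaries. -/
def directSumUnitary {K : Type} {X : K → Type} [∀ k, NormedAddCommGroup (X k)]
    [∀ k, InnerProductSpace ℂ (X k)] (U : ∀ k, X k ≃ₗᵢ[ℂ] X k) : lp X 2 ≃ₗᵢ[ℂ] lp X 2 where
  toFun f := ⟨fun k => U k (f k), (memℓp_gen_iff (by simp)).2 (by
    simpa using (memℓp_gen_iff (by simp)).1 (lp.memℓp f))⟩
  invFun f := ⟨fun k => (U k).symm (f k), (memℓp_gen_iff (by simp)).2 (by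
    simpa using (memℓp_gen_iff (by simp)).1 (lp.memℓp f))⟩
  map_add' f g := by ext k; exact map_add (U k) (f k) (g k)
  map_smul' c f := by ext k; simp
  left_inv f := by ext k; simp
  right_inv f := by ext k; simp
  norm_map' f := by
    rw [lp.norm_eq_tsum_rpow (by simp), lp.norm_eq_tsum_rpow (by simp)]
    simp

/-- For a unitary `T` of `E`, the unitary `T ⊗ I` of `E ⊗ (⨁ₖ G (base k))`, transported to
`⨁ G`. -/
def Splitting.amplify (σ : Splitting E G) (T : E.carrier ≃ₗᵢ[ℂ] E.carrier) :
    HilbertSum G ≃ₗᵢ[ℂ] HilbertSum G :=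
  (σ.equiv.trans (directSumUnitary fun k =>
    completionUnitary (T.rTensor (G (σ.base k)).carrier))).trans σ.equiv.symm

end Splitting
section FreeProduct

variable {ι : Type} (E : ι → PointedHilbert)

/-- `E°_{i₁} ⊗ (E°_{i₂} ⊗ (⋯ ⊗ (E°_{iₙ} ⊗ ℂ)))` for the word `i₁ i₂ ⋯ iₙ`. -/
def wordSpace : List ι → PreHilbert
  | [] => ⟨ℂ⟩
  | i :: w => ⟨(E i).Circ ⊗[ℂ] (wordSpace w).carrier⟩

/-- The canonical identification of the space of the word `w i` with the tensor product of the
space of the word `w` and `E°_i`. -/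
def wordSpaceConcat : ∀ (w : List ι) (i : ι),
    (wordSpace E (w ++ [i])).carrier ≃ₗᵢ[ℂ] (wordSpace E w).carrier ⊗[ℂ] (E i).Circ
  | [], i => TensorProduct.commIsometry ℂ (E i).Circ ℂ
  | j :: w, i =>
    ((wordSpaceConcat w i).lTensor (E j).Circ).trans
      (TensorProduct.assocIsometry ℂ (E j).Circ (wordSpace E w).carrier (E i).Circ).symm

/-- The alternating words. -/
abbrev Word (ι : Type) : Type := {w : List ι // w.IsChain (· ≠ ·)}

/-- The Hilbert space free product `ℂξ ⊕ ⨁ E°_{i₁} ⊗ ⋯ ⊗ E°_{iₙ}`, where the sum is over `n ≥ 1`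
and `i₁ ≠ i₂ ≠ ⋯ ≠ iₙ`. -/
abbrev FreeProduct : Type := HilbertSum (fun w : Word ι => wordSpace E w.1)

/-- The number `1` in the space `ℂ` of the empty word. -/
def emptyTensor : (wordSpace E []).carrier := (1 : ℂ)

lemma norm_emptyTensor : ‖emptyTensor E‖ = 1 := norm_one (α := ℂ)

open scoped Classical in
/-- The distinguished unit vector of the free product. -/
def vacuum : FreeProduct E :=
  lp.single 2 (⟨[], List.isChain_nil⟩ : Word ι)
    ((emptyTensor E : (wordSpace E []).carrier) : UniformSpace.Completion (wordSpace E []).carrier)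

lemma norm_vacuum : ‖vacuum E‖ = 1 := by
  classical
  refine (lp.norm_single (by simp) _ _).trans ?_
  rw [UniformSpace.Completion.norm_coe, norm_emptyTensor]

/-- The identification `E_i ⊗ H(ℓ, i) ≃ H`, where `H` is the free product and `H(ℓ, i)` is the sum
of the spaces of the alternating words that do not begin with `i`. -/
def leftSplitting (i : ι) : Splitting (E i) (fun w : Word ι => wordSpace E w.1) where
  K := {w : Word ι // w.1.head? ≠ some i}
  base k := k.1
  ext k := ⟨i :: k.1.1, List.isChain_cons.2 ⟨fun j hj h => k.2 (h ▸ hj), k.1.2⟩⟩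
  base_injective := Subtype.val_injective
  ext_injective k l h := by
    have := congrArg Subtype.val h
    exact Subtype.ext (Subtype.ext (List.cons_injective this))
  base_ne_ext k l h := k.2 (by rw [h]; rfl)
  cover w := by
    by_cases h : w.1.head? = some i
    · right
      obtain ⟨_ | ⟨j, w⟩, hw⟩ := w
      · simp at h
      · obtain rfl : j = i := by simpa using h
        have := List.isChain_cons.1 hw
        exact ⟨⟨⟨w, this.2⟩, fun h => this.1 _ h rfl⟩, rfl⟩
    · exact Or.inl ⟨⟨w, h⟩, rfl⟩
  iso k := LinearIsometryEquiv.refl ℂ _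

/-- The identification `H(r, i) ⊗ E_i ≃ H`, where `H` is the free product and `H(r, i)` is the sum
of the spaces of the alternating words that do not end with `i`. -/
def rightSplitting (i : ι) : Splitting (E i) (fun w : Word ι => wordSpace E w.1) where
  K := {w : Word ι // w.1.getLast? ≠ some i}
  base k := k.1
  ext k := ⟨k.1.1 ++ [i], List.isChain_append.2 ⟨k.1.2, List.isChain_singleton _, by
    rintro x hx y hy rfl
    simp only [List.head?_cons, Option.mem_def, Option.some.injEq] at hy
    exact k.2 (hy ▸ hx)⟩⟩
  base_injective := Subtype.val_injective
  ext_injective k l h := by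
    have := congrArg Subtype.val h
    exact Subtype.ext (Subtype.ext (List.append_cancel_right this))
  base_ne_ext k l h := k.2 (by rw [h]; simp)
  cover w := by
    by_cases h : w.1.getLast? = some i
    · right
      obtain ⟨w, hw⟩ := w
      obtain ⟨w', rfl⟩ := List.getLast?_eq_some_iff.1 h
      have := List.isChain_append.1 hw
      exact ⟨⟨⟨w', this.1⟩, fun h => this.2.2 _ h _ (by simp) rfl⟩, rfl⟩
    · exact Or.inl ⟨⟨w, h⟩, rfl⟩
  iso k := (TensorProduct.commIsometry ℂ (E i).Circ (wordSpace E k.1.1).carrier).trans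
    (wordSpaceConcat E k.1.1 i).symm

variable {E}

/-- The left variable `λ_i(T)` of a unitary `T` of `E_i`. -/
def leftVariable (i : ι) (T : (E i).carrier ≃ₗᵢ[ℂ] (E i).carrier) :
    unitary (FreeProduct E →L[ℂ] FreeProduct E) :=
  Unitary.linearIsometryEquiv.symm ((leftSplitting E i).amplify T)

/-- The right variable `ρ_i(T)` of a unitary `T` of `E_i`. -/
def rightVariable (i : ι) (T : (E i).carrier ≃ₗᵢ[ℂ] (E i).carrier) :
    unitary (FreeProduct E →L[ℂ] FreeProduct E) :=
  Unitary.linearIsometryEquiv.symm ((rightSplitting E i).amplify T)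

end FreeProduct

section Convolution

/-- The vector state `T ↦ ⟨T ξ, ξ⟩`. -/
def vectorState {H : Type*} [NormedAddCommGroup H] [InnerProductSpace ℂ H] [CompleteSpace H]
    (ξ : H) (hξ : ‖ξ‖ = 1) : State (H →L[ℂ] H) where
  toLinearMap :=
    { toFun := fun T => ⟪ξ, T ξ⟫_ℂ
      map_add' := fun S T => inner_add_right _ _ _
      map_smul' := fun c T => inner_smul_right _ _ _ }
  map_nonneg T := by
    change 0 ≤ ⟪ξ, (ContinuousLinearMap.adjoint T) (T ξ)⟫_ℂ
    rw [ContinuousLinearMap.adjoint_inner_right]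
    rw [inner_self_eq_norm_sq_to_K, ← RCLike.ofReal_pow]
    exact Complex.zero_le_real.2 (sq_nonneg ‖T ξ‖)
  map_one := by
    change ⟪ξ, ξ⟫_ℂ = 1
    rw [inner_self_eq_norm_sq_to_K, hξ]
    simp

/-- The space `L²(μ)` with the constant function one. -/
def l2 (μ : ProbabilityMeasure Torus) : PointedHilbert where
  carrier := Lp ℂ 2 (μ : Measure Torus)
  vec := Lp.const 2 (μ : Measure Torus) (1 : ℂ)
  norm_vec := by
    have h := Lp.norm_const (p := 2) (μ := (μ : Measure Torus)) (c := (1 : ℂ)) (by simp)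
    exact h.trans (by simp)

lemma memLp_circle_mul (μ : ProbabilityMeasure Torus) {g : Torus → Circle} (hg : Measurable g)
    (f : Lp ℂ 2 (μ : Measure Torus)) :
    MemLp (fun x => (g x : ℂ) * f x) 2 (μ : Measure Torus) := by
  refine (Lp.memLp f).of_le ?_ (Filter.Eventually.of_forall fun x => ?_)
  · exact ((by fun_prop : Measurable fun x => (g x : ℂ)).aestronglyMeasurable).mul
      (Lp.aestronglyMeasurable f)
  · rw [norm_mul, Circle.norm_coe, one_mul]

/-- The operator on `L²(μ)` of multiplication by a measurable function `g` with values in the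
circle, as a linear isometry. -/
def mulIsometry (μ : ProbabilityMeasure Torus) (g : Torus → Circle) (hg : Measurable g) :
    Lp ℂ 2 (μ : Measure Torus) →ₗᵢ[ℂ] Lp ℂ 2 (μ : Measure Torus) where
  toFun f := (memLp_circle_mul μ hg f).toLp
  map_add' f f' := by
    rw [← MemLp.toLp_add]
    refine MemLp.toLp_congr _ _ ?_
    filter_upwards [Lp.coeFn_add f f'] with x hx
    rw [hx, Pi.add_apply, Pi.add_apply, mul_add]
  map_smul' c f := by
    rw [RingHom.id_apply, ← MemLp.toLp_const_smul]
    refine MemLp.toLp_congr _ _ ?_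
    filter_upwards [Lp.coeFn_smul c f] with x hx
    rw [hx, Pi.smul_apply, Pi.smul_apply, smul_eq_mul, smul_eq_mul, mul_left_comm]
  norm_map' f := by
    change ‖(memLp_circle_mul μ hg f).toLp‖ = ‖f‖
    rw [Lp.norm_toLp, Lp.norm_def]
    congr 1
    refine eLpNorm_congr_norm_ae (Filter.Eventually.of_forall fun x => ?_)
    rw [norm_mul, Circle.norm_coe, one_mul]

lemma mulIsometry_comp (μ : ProbabilityMeasure Torus) (g g' : Torus → Circle) (hg : Measurable g)
    (hg' : Measurable g') (h : ∀ x, g x * g' x = 1) (f : Lp ℂ 2 (μ : Measure Torus)) :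
    mulIsometry μ g hg (mulIsometry μ g' hg' f) = f := by
  refine Lp.ext ?_
  filter_upwards [(memLp_circle_mul μ hg (mulIsometry μ g' hg' f)).coeFn_toLp,
    (memLp_circle_mul μ hg' f).coeFn_toLp] with x hx hx'
  refine hx.trans ?_
  change (g x : ℂ) * ((memLp_circle_mul μ hg' f).toLp : Torus → ℂ) x = f x
  rw [hx', ← mul_assoc, ← Circle.coe_mul, h, Circle.coe_one, one_mul]

/-- The unitary operator on `L²(μ)` of multiplication by a measurable function `g` with values in
the circle. -/
def mulUnitary (μ : ProbabilityMeasure Torus) (g : Torus → Circle) (hg : Measurable g) :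
    (l2 μ).carrier ≃ₗᵢ[ℂ] (l2 μ).carrier :=
  LinearIsometryEquiv.mk
    (LinearEquiv.ofLinearMap (mulIsometry μ g hg).toLinearMap
      (mulIsometry μ (fun x => (g x)⁻¹) hg.inv).toLinearMap
      (LinearMap.ext fun f => mulIsometry_comp μ g _ hg hg.inv (fun _ => mul_inv_cancel _) f)
      (LinearMap.ext fun f => mulIsometry_comp μ _ g hg.inv hg (fun _ => inv_mul_cancel _) f))
    (mulIsometry μ g hg).norm_map

variable (μ : Fin 2 → ProbabilityMeasure Torus) (i : Fin 2)

/-- The left variable `u_i = λ_i(S_i)`, where `S_i` is the multiplication by the first coordinate on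
`L²(μ_i)`. -/
def leftU : unitary (FreeProduct (fun i => l2 (μ i)) →L[ℂ] FreeProduct (fun i => l2 (μ i))) :=
  leftVariable i (mulUnitary (μ i) Prod.fst measurable_fst)

/-- The right variable `v_i = ρ_i(T_i)`, where `T_i` is the multiplication by the second coordinate
on `L²(μ_i)`. -/
def rightV : unitary (FreeProduct (fun i => l2 (μ i)) →L[ℂ] FreeProduct (fun i => l2 (μ i))) :=
  rightVariable i (mulUnitary (μ i) Prod.snd measurable_snd)

/-- The state of the vacuum vector of the free product of `L²(μ_0)` and `L²(μ_1)`. -/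
def vacuumState :
    State (FreeProduct (fun i => l2 (μ i)) →L[ℂ] FreeProduct (fun i => l2 (μ i))) :=
  vectorState (vacuum fun i => l2 (μ i)) (norm_vacuum _)

/-- The bi-free multiplicative convolution `μ₁ ⊠⊠ μ₂`: the distribution of `(u₁ u₂, v₁ v₂)`. -/
def convolution (μ₁ μ₂ : ProbabilityMeasure Torus) : ProbabilityMeasure Torus :=
  distribution (vacuumState ![μ₁, μ₂]) (leftU ![μ₁, μ₂] 0 * leftU ![μ₁, μ₂] 1)
    (rightV ![μ₁, μ₂] 0 * rightV ![μ₁, μ₂] 1)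

end Convolution

end BiFree

end

noncomputable section

namespace BiFree

/-! ### Amplified unitaries on elementary tensors -/

section Splitting

variable {W : Type} {E : PointedHilbert} {G : W → PreHilbert}

/-! Write `U = u₁u₂` and `V = v₁v₂`. A probability measure on the torus is determined by its
moments, so the convolution is uniform exactly when `⟨ξ, U^m V^n ξ⟩ = ⟨U^{-m} ξ, V^n ξ⟩` vanishes
for all `(m, n) ≠ (0, 0)`. Both vectors on the right can be computed explicitly.

Centredness says that `S_i ξ_i` and `T_i ξ_i`, and hence also `S_i⁻¹ ξ_i` and `T_i⁻¹ ξ_i`, lie in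
`H_i°`. Left variables then only prepend letters to an alternating word that starts from the vacuum,
and right variables only append them. So for `n ≥ 0` the vectors `U^n ξ` and `V^{-n} ξ` are
elementary tensors in the summand of the word `(12)^n`, while `U^{-n} ξ` and `V^n ξ` are elementary
tensors in the summand of `(21)^n`. Different words are orthogonal. Exponents of opposite sign, not
both zero, therefore give moment zero, and so do exponents of different absolute value. For `m = n ≥
0` the inner product factors over the letters and equals `(φ(u₁v₁) φ(u₂v₂))^n`, and for `m = n < 0`
it is the conjugate of the moment for `-n`. The moment `(1, 1)` thus gives one implication, and the
vanishing of the product gives the other.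

The action on words is in `left_pow_vacuum` and `right_pow_vacuum`, the moments are in
`inner_vacuum_mul` and `inner_vacuum_zpow_mul_zpow_eq_zero`, and the determination by moments is
`eq_uniform_iff`.

The distribution of `(U, V)` has its meaning only once `U` and `V` are known to commute. The reason
is that left and right variables act on opposite ends of a tensor (`twoSidedVec_eq`), except on the
copy of `H_i` spanned by `ξ` and the one-letter word `i`, where they act as `S_i` and `T_i`.

The statement for arbitrary commuting pairs reduces to that for measures, because all hypotheses are
moments of the distributions. -/

open scoped Classical in
/-- The inclusion of a summand into the Hilbert space direct sum. -/
def summandIncl (G : W → PreHilbert) (a : W) : (G a).carrier →ₗ[ℂ] HilbertSum G :=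
  (lp.lsingle (𝕜 := ℂ) 2 a).comp
    (UniformSpace.Completion.toComplₗᵢ (𝕜 := ℂ) (E := (G a).carrier)).toLinearMap

/-- The definition fixes the classical decidability instance; here any instance is allowed. -/
lemma summandIncl_apply [inst : DecidableEq W] (a : W) (x : (G a).carrier) :
    summandIncl G a x = lp.single 2 a (x : UniformSpace.Completion (G a).carrier) := by
  obtain rfl : inst = fun a b => Classical.propDecidable (a = b) := Subsingleton.elim _ _
  rfl

lemma summandIncl_inner_self (a : W) (x y : (G a).carrier) :
    ⟪summandIncl G a x, summandIncl G a y⟫_ℂ = ⟪x, y⟫_ℂ := by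
  classical
  change ⟪(lp.single 2 a (x : UniformSpace.Completion (G a).carrier) : HilbertSum G),
    lp.single 2 a (y : UniformSpace.Completion (G a).carrier)⟫_ℂ = _
  rw [lp.inner_single_left, lp.single_apply_self, UniformSpace.Completion.inner_coe]

lemma summandIncl_inner_of_ne {a b : W} (h : a ≠ b) (x : (G a).carrier) (y : (G b).carrier) :
    ⟪summandIncl G a x, summandIncl G b y⟫_ℂ = 0 := by
  classical
  change ⟪(lp.single 2 a (x : UniformSpace.Completion (G a).carrier) : HilbertSum G),
    lp.single 2 b (y : UniformSpace.Completion (G b).carrier)⟫_ℂ = _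
  rw [lp.inner_single_left, lp.single_apply_ne _ _ _ h, inner_zero_right]

/-- Continuous linear maps on the direct sum agree if they agree on all summands. -/
lemma hilbertSum_ext {F : Type*} [NormedAddCommGroup F] [NormedSpace ℂ F]
    {f g : HilbertSum G →L[ℂ] F}
    (h : ∀ a x, f (summandIncl G a x) = g (summandIncl G a x)) : f = g := by
  classical
  -- Each summand is a completion, so density and continuity extend the hypothesis to all its
  -- elements.
  have hc : ∀ a (x : UniformSpace.Completion (G a).carrier),
      f (lp.single 2 a x) = g (lp.single 2 a x) := by
    intro a x
    have hs : Continuous fun x : UniformSpace.Completion (G a).carrier =>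
        (lp.single 2 a x : HilbertSum G) :=
      (lp.singleContinuousLinearMap ℂ (fun a => UniformSpace.Completion (G a).carrier) 2
        a).continuous
    induction x using UniformSpace.Completion.induction_on with
    | hp => exact isClosed_eq (f.continuous.comp hs) (g.continuous.comp hs)
    | ih x => exact h a x
  ext v
  have hv := lp.hasSum_single (E := fun a => UniformSpace.Completion (G a).carrier) (p := 2)
    (by simp) v
  refine (hv.mapL f).unique ?_
  convert hv.mapL g using 2 with w
  exact hc _ _

namespace Splitting

variable (σ : Splitting E G) (k : σ.K)

/-- The vector of the direct sum which corresponds to the elementary tensor `h ⊗ x`. -/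
def tmulVec (h : E.carrier) (x : (G (σ.base k)).carrier) : HilbertSum G :=
  σ.embed k ((h ⊗ₜ[ℂ] x : E.carrier ⊗[ℂ] (G (σ.base k)).carrier) :
    UniformSpace.Completion (E.carrier ⊗[ℂ] (G (σ.base k)).carrier))

/-- This is the decomposition `h = ⟨ξ, h⟩ ξ + h°`: the vacuum part stays in the base summand, the
rest goes to the extended one. -/
lemma tmulVec_eq (h : E.carrier) (x : (G (σ.base k)).carrier) :
    σ.tmulVec k h x = ⟪E.vec, h⟫_ℂ • summandIncl G (σ.base k) x
      + summandIncl G (σ.ext k) (σ.iso k (E.proj h ⊗ₜ x)) := by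
  classical
  rw [tmulVec, embed_apply, vacC, circC, ContinuousLinearMap.completion_apply_coe,
    ContinuousLinearMap.completion_apply_coe, ← map_smul]
  congr 2

lemma tmulVec_vec (x : (G (σ.base k)).carrier) :
    σ.tmulVec k E.vec x = summandIncl G (σ.base k) x := by
  rw [tmulVec_eq, E.proj_vec, inner_self_eq_norm_sq_to_K, E.norm_vec]
  simp

lemma tmulVec_incl (h : E.Circ) (x : (G (σ.base k)).carrier) :
    σ.tmulVec k (E.incl h) x = summandIncl G (σ.ext k) (σ.iso k (h ⊗ₜ x)) := by
  rw [tmulVec_eq, E.proj_incl, E.inner_vec_incl]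
  simp

lemma completionUnitary_coe {X : Type} [NormedAddCommGroup X] [InnerProductSpace ℂ X]
    (U : X ≃ₗᵢ[ℂ] X) (x : X) : completionUnitary U (x : UniformSpace.Completion X) =
      (U x : UniformSpace.Completion X) :=
  U.toLinearEquiv.extendOfIsometry_eq
    (e₁ := UniformSpace.Completion.toComplₗᵢ.toLinearMap)
    (e₂ := UniformSpace.Completion.toComplₗᵢ.toLinearMap) UniformSpace.Completion.denseRange_coe
    UniformSpace.Completion.denseRange_coe (fun x => by simp) x

open scoped Classical in
lemma directSumUnitary_single {K : Type} {X : K → Type} [∀ k, NormedAddCommGroup (X k)]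
    [∀ k, InnerProductSpace ℂ (X k)] (U : ∀ k, X k ≃ₗᵢ[ℂ] X k) (k : K) (x : X k) :
    directSumUnitary U (lp.single 2 k x) = lp.single 2 k (U k x) := by
  ext l
  change U l ((lp.single 2 k x : lp X 2) l) = _
  by_cases h : l = k
  · subst h; simp
  · rw [lp.single_apply_ne _ _ _ h, lp.single_apply_ne _ _ _ h, map_zero]

/-- Through `σ.equiv` the map `σ.embed k` is the inclusion of the `k`-th summand, on which the
operator is `T ⊗ I` by construction. All later computations with left and right variables rest on
this. -/
lemma amplify_tmulVec (T : E.carrier ≃ₗᵢ[ℂ] E.carrier) (h : E.carrier)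
    (x : (G (σ.base k)).carrier) : σ.amplify T (σ.tmulVec k h x) = σ.tmulVec k (T h) x := by
  classical
  have key : ∀ z, σ.embed k z = σ.equiv.symm (lp.single 2 k z) := fun z =>
    (IsHilbertSum.linearIsometryEquiv_symm_apply_single σ.isHilbertSum_embed z).symm
  rw [tmulVec, tmulVec, key, key, amplify]
  simp only [LinearIsometryEquiv.trans_apply, LinearIsometryEquiv.apply_symm_apply]
  rw [directSumUnitary_single, completionUnitary_coe]
  simp

end Splitting

end Splitting

/-! ### Adding letters to tensors on either side -/

section FreeProduct

variable {ι : Type} (E : ι → PointedHilbert)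

/-- The inclusion of the space of a word into the free product. -/
abbrev wordIncl (w : Word ι) : (wordSpace E w.1).carrier →ₗ[ℂ] FreeProduct E :=
  summandIncl (fun w : Word ι => wordSpace E w.1) w

/-- The tensor product of a vector and a vector of the space of a word, as a vector of the space of
the word extended on the left. -/
def consTensor (i : ι) (w : List ι) (h : (E i).Circ) (x : (wordSpace E w).carrier) :
    (wordSpace E (i :: w)).carrier :=
  (h ⊗ₜ[ℂ] x : (E i).Circ ⊗[ℂ] (wordSpace E w).carrier)

/-- The tensor product of a vector of the space of a word and a vector, as a vector of the space of
the word extended on the right. -/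
def snocTensor (i : ι) (w : List ι) (x : (wordSpace E w).carrier) (h : (E i).Circ) :
    (wordSpace E (w ++ [i])).carrier :=
  (wordSpaceConcat E w i).symm (x ⊗ₜ[ℂ] h)

/-- Associativity of the tensor product. This is the algebraic source of the commutation of left and
right variables. -/
lemma snocTensor_consTensor (i j : ι) (w : List ι) (h : (E i).Circ) (x : (wordSpace E w).carrier)
    (h' : (E j).Circ) : snocTensor E j (i :: w) (consTensor E i w h x) h' =
      consTensor E i (w ++ [j]) h (snocTensor E j w x h') := by
  change (((wordSpaceConcat E w j).lTensor (E i).Circ).trans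
      (TensorProduct.assocIsometry ℂ (E i).Circ (wordSpace E w).carrier (E j).Circ).symm).symm
        ((h ⊗ₜ[ℂ] x) ⊗ₜ[ℂ] h') = h ⊗ₜ[ℂ] (wordSpaceConcat E w j).symm (x ⊗ₜ[ℂ] h')
  simp [LinearIsometryEquiv.symm_trans, LinearIsometryEquiv.symm_lTensor]

lemma snocTensor_nil (i : ι) (h : (E i).Circ) :
    snocTensor E i [] (emptyTensor E) h = consTensor E i [] h (emptyTensor E) := by
  change (TensorProduct.commIsometry ℂ (E i).Circ ℂ).symm ((1 : ℂ) ⊗ₜ[ℂ] h) = h ⊗ₜ[ℂ] (1 : ℂ)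
  simp

end FreeProduct

/-! ### Left and right variables, and their commutation -/

section FreeProduct

variable {ι : Type} {E : ι → PointedHilbert}

lemma chain_tail {i : ι} {w : List ι} (hw : (i :: w).IsChain (· ≠ ·)) : w.IsChain (· ≠ ·) :=
  (List.isChain_cons.1 hw).2

lemma chain_init {i : ι} {w : List ι} (hw : (w ++ [i]).IsChain (· ≠ ·)) : w.IsChain (· ≠ ·) :=
  (List.isChain_append.1 hw).1

lemma chain_head {i : ι} {w : List ι} (hw : (i :: w).IsChain (· ≠ ·)) : w.head? ≠ some i :=
  fun h => (List.isChain_cons.1 hw).1 i h rfl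

lemma chain_last {i : ι} {w : List ι} (hw : (w ++ [i]).IsChain (· ≠ ·)) : w.getLast? ≠ some i :=
  fun h => (List.isChain_append.1 hw).2.2 i h i rfl rfl

/-- The vector of the free product which corresponds to `h ⊗ x` under `E_i ⊗ H(ℓ, i) ≃ H`. -/
def leftVec (i : ι) (w : List ι) (hw : (i :: w).IsChain (· ≠ ·)) (h : (E i).carrier)
    (x : (wordSpace E w).carrier) : FreeProduct E :=
  ⟪(E i).vec, h⟫_ℂ • wordIncl E ⟨w, chain_tail hw⟩ x
    + wordIncl E ⟨i :: w, hw⟩ (consTensor E i w ((E i).proj h) x)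

/-- The vector of the free product which corresponds to `x ⊗ h` under `H(r, i) ⊗ E_i ≃ H`. -/
def rightVec (i : ι) (w : List ι) (hw : (w ++ [i]).IsChain (· ≠ ·))
    (x : (wordSpace E w).carrier) (h : (E i).carrier) : FreeProduct E :=
  ⟪(E i).vec, h⟫_ℂ • wordIncl E ⟨w, chain_init hw⟩ x
    + wordIncl E ⟨w ++ [i], hw⟩ (snocTensor E i w x ((E i).proj h))

lemma leftVariable_leftVec (i : ι) (T : (E i).carrier ≃ₗᵢ[ℂ] (E i).carrier) (w : List ι)
    (hw : (i :: w).IsChain (· ≠ ·)) (h : (E i).carrier) (x : (wordSpace E w).carrier) :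
    (leftVariable i T : FreeProduct E →L[ℂ] FreeProduct E) (leftVec i w hw h x) =
      leftVec i w hw (T h) x := by
  have key : ∀ h, leftVec i w hw h x =
      (leftSplitting E i).tmulVec ⟨⟨w, chain_tail hw⟩, chain_head hw⟩ h x := fun h =>
    ((leftSplitting E i).tmulVec_eq ⟨⟨w, chain_tail hw⟩, chain_head hw⟩ h x).symm
  rw [key, key]
  exact (leftSplitting E i).amplify_tmulVec ⟨⟨w, chain_tail hw⟩, chain_head hw⟩ T h x

lemma rightVariable_rightVec (i : ι) (T : (E i).carrier ≃ₗᵢ[ℂ] (E i).carrier) (w : List ι)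
    (hw : (w ++ [i]).IsChain (· ≠ ·)) (x : (wordSpace E w).carrier) (h : (E i).carrier) :
    (rightVariable i T : FreeProduct E →L[ℂ] FreeProduct E) (rightVec i w hw x h) =
      rightVec i w hw x (T h) := by
  have key : ∀ h, rightVec i w hw x h =
      (rightSplitting E i).tmulVec ⟨⟨w, chain_init hw⟩, chain_last hw⟩ h x := fun h =>
    ((rightSplitting E i).tmulVec_eq ⟨⟨w, chain_init hw⟩, chain_last hw⟩ h x).symm
  rw [key, key]
  exact (rightSplitting E i).amplify_tmulVec ⟨⟨w, chain_init hw⟩, chain_last hw⟩ T h x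

lemma leftVec_vec (i : ι) (w : List ι) (hw : (i :: w).IsChain (· ≠ ·))
    (x : (wordSpace E w).carrier) :
    leftVec i w hw (E i).vec x = wordIncl E ⟨w, chain_tail hw⟩ x :=
  ((leftSplitting E i).tmulVec_eq ⟨⟨w, chain_tail hw⟩, chain_head hw⟩ _ x).symm.trans
    ((leftSplitting E i).tmulVec_vec ⟨⟨w, chain_tail hw⟩, chain_head hw⟩ x)

lemma leftVec_incl (i : ι) (w : List ι) (hw : (i :: w).IsChain (· ≠ ·)) (h : (E i).Circ)
    (x : (wordSpace E w).carrier) :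
    leftVec i w hw ((E i).incl h) x = wordIncl E ⟨i :: w, hw⟩ (consTensor E i w h x) :=
  ((leftSplitting E i).tmulVec_eq ⟨⟨w, chain_tail hw⟩, chain_head hw⟩ _ x).symm.trans
    ((leftSplitting E i).tmulVec_incl ⟨⟨w, chain_tail hw⟩, chain_head hw⟩ h x)

lemma rightVec_vec (i : ι) (w : List ι) (hw : (w ++ [i]).IsChain (· ≠ ·))
    (x : (wordSpace E w).carrier) :
    rightVec i w hw x (E i).vec = wordIncl E ⟨w, chain_init hw⟩ x :=
  ((rightSplitting E i).tmulVec_eq ⟨⟨w, chain_init hw⟩, chain_last hw⟩ _ x).symm.trans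
    ((rightSplitting E i).tmulVec_vec ⟨⟨w, chain_init hw⟩, chain_last hw⟩ x)

lemma rightVec_incl (i : ι) (w : List ι) (hw : (w ++ [i]).IsChain (· ≠ ·)) (h : (E i).Circ)
    (x : (wordSpace E w).carrier) :
    rightVec i w hw x ((E i).incl h) = wordIncl E ⟨w ++ [i], hw⟩ (snocTensor E i w x h) :=
  ((rightSplitting E i).tmulVec_eq ⟨⟨w, chain_init hw⟩, chain_last hw⟩ _ x).symm.trans
    ((rightSplitting E i).tmulVec_incl ⟨⟨w, chain_init hw⟩, chain_last hw⟩ h x)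

/-- Over the empty word the left and right pictures are the same copy of `E_i`. Here a left and a
right variable with the same index genuinely interact. -/
lemma rightVec_nil (i : ι) (hw : [i].IsChain (· ≠ ·)) (x : (wordSpace E []).carrier)
    (h : (E i).carrier) : rightVec i [] hw x h = leftVec i [] hw h x := by
  have : snocTensor E i [] x ((E i).proj h) = consTensor E i [] ((E i).proj h) x := by
    change (TensorProduct.commIsometry ℂ (E i).Circ ℂ).symm (_ ⊗ₜ[ℂ] _) = _ ⊗ₜ[ℂ] _
    rw [TensorProduct.commIsometry_symm]
    rfl
  rw [rightVec, leftVec]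
  exact congrArg (fun y => _ + wordIncl E ⟨[i], hw⟩ y) this

/-- The sum over the four words `m`, `i m`, `m j`, `i m j` which corresponds to `h ⊗ x ⊗ h'`. -/
def twoSidedVec (i j : ι) (m : List ι) (hm : (i :: (m ++ [j])).IsChain (· ≠ ·))
    (h : (E i).carrier) (x : (wordSpace E m).carrier) (h' : (E j).carrier) : FreeProduct E :=
  ⟪(E j).vec, h'⟫_ℂ • leftVec i m (chain_init (w := i :: m) hm) h x
    + leftVec i (m ++ [j]) hm h (snocTensor E j m x ((E j).proj h'))

/-- The same four terms, grouped by the right factor instead of the left one. One grouping shows the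
action of left variables, the other that of right variables. -/
lemma twoSidedVec_eq (i j : ι) (m : List ι) (hm : (i :: (m ++ [j])).IsChain (· ≠ ·))
    (h : (E i).carrier) (x : (wordSpace E m).carrier) (h' : (E j).carrier) :
    twoSidedVec i j m hm h x h' = ⟪(E i).vec, h⟫_ℂ • rightVec j m (chain_tail hm) x h'
      + rightVec j (i :: m) hm (consTensor E i m ((E i).proj h) x) h' := by
  have e : wordIncl E ⟨i :: m ++ [j], hm⟩
      (snocTensor E j (i :: m) (consTensor E i m ((E i).proj h) x) ((E j).proj h')) =
      wordIncl E ⟨i :: (m ++ [j]), hm⟩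
        (consTensor E i (m ++ [j]) ((E i).proj h) (snocTensor E j m x ((E j).proj h'))) :=
    congrArg (wordIncl E ⟨i :: (m ++ [j]), hm⟩) (snocTensor_consTensor E i j m _ _ _)
  rw [twoSidedVec, leftVec, leftVec, rightVec, rightVec, e]
  module

lemma leftVariable_twoSidedVec (i j : ι) (S : (E i).carrier ≃ₗᵢ[ℂ] (E i).carrier) (m : List ι)
    (hm : (i :: (m ++ [j])).IsChain (· ≠ ·)) (h : (E i).carrier) (x : (wordSpace E m).carrier)
    (h' : (E j).carrier) :
    (leftVariable i S : FreeProduct E →L[ℂ] FreeProduct E) (twoSidedVec i j m hm h x h') =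
      twoSidedVec i j m hm (S h) x h' := by
  rw [twoSidedVec, map_add, map_smul, leftVariable_leftVec, leftVariable_leftVec, twoSidedVec]

lemma rightVariable_twoSidedVec (i j : ι) (T : (E j).carrier ≃ₗᵢ[ℂ] (E j).carrier) (m : List ι)
    (hm : (i :: (m ++ [j])).IsChain (· ≠ ·)) (h : (E i).carrier) (x : (wordSpace E m).carrier)
    (h' : (E j).carrier) :
    (rightVariable j T : FreeProduct E →L[ℂ] FreeProduct E) (twoSidedVec i j m hm h x h') =
      twoSidedVec i j m hm h x (T h') := by
  rw [twoSidedVec_eq, map_add, map_smul, rightVariable_rightVec, rightVariable_rightVec,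
    twoSidedVec_eq]

/-- Two continuous linear maps on the free product agree if they agree on all two-sided vectors
and, for `i = j`, on `E_i`. -/
lemma freeProduct_ext (i j : ι) {f g : FreeProduct E →L[ℂ] FreeProduct E}
    (h₁ : i = j → ∀ h x, f (leftVec i [] (List.isChain_singleton _) h x) =
      g (leftVec i [] (List.isChain_singleton _) h x))
    (h₂ : ∀ m hm h x h', f (twoSidedVec i j m hm h x h') = g (twoSidedVec i j m hm h x h')) :
    f = g := by
  -- Elementary tensors span, so on words beginning with `i` it is enough to test vectors `leftVec`
  -- with `h` in `E_i°`.
  have hcons : ∀ w (hw : (i :: w).IsChain (· ≠ ·)),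
      (∀ h x, f (leftVec i w hw h x) = g (leftVec i w hw h x)) →
      ∀ x, f (wordIncl E ⟨i :: w, hw⟩ x) = g (wordIncl E ⟨i :: w, hw⟩ x) := by
    intro w hw H
    refine LinearMap.congr_fun (f := f.toLinearMap ∘ₗ wordIncl E ⟨i :: w, hw⟩)
      (g := g.toLinearMap ∘ₗ wordIncl E ⟨i :: w, hw⟩)
      (TensorProduct.ext' (M := (E i).Circ) (N := (wordSpace E w).carrier) fun h x => ?_)
    have := H ((E i).incl h) x
    rw [leftVec_incl] at this
    exact this
  -- The same spanning argument at the right end, through `wordSpaceConcat`.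
  have hsnoc : ∀ w (c : (wordSpace E (w ++ [j])).carrier →ₗ[ℂ] FreeProduct E),
      (∀ x h, f (c (snocTensor E j w x h)) = g (c (snocTensor E j w x h))) →
      ∀ x, f (c x) = g (c x) := by
    intro w c H x
    obtain ⟨y, rfl⟩ := (wordSpaceConcat E w j).symm.surjective x
    induction y using TensorProduct.induction_on with
    | zero => simp
    | add x y hx hy => simp only [map_add, hx, hy]
    | tmul x h => exact H x h
  have hleft : ∀ w (hw : (i :: w).IsChain (· ≠ ·)) h x,
      f (leftVec i w hw h x) = g (leftVec i w hw h x) := by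
    intro w hw h x
    -- This is the one case without a two-sided vector: neither does the empty word end with `j`,
    -- nor is `i j` alternating.
    by_cases hs : w = [] ∧ i = j
    · obtain ⟨rfl, hij⟩ := hs
      exact h₁ hij h x
    by_cases hl : w.getLast? = some j
    -- If `w` ends with `j`, its last factor is taken as an `h'` in `E_j°`, which kills the first
    -- term of the two-sided vector.
    · obtain ⟨m, rfl⟩ := List.getLast?_eq_some_iff.1 hl
      let c : (wordSpace E (m ++ [j])).carrier →ₗ[ℂ] FreeProduct E :=
        ⟪(E i).vec, h⟫_ℂ • wordIncl E ⟨m ++ [j], chain_tail hw⟩ +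
          wordIncl E ⟨i :: (m ++ [j]), hw⟩ ∘ₗ
          TensorProduct.mk ℂ (E i).Circ (wordSpace E (m ++ [j])).carrier ((E i).proj h)
      refine hsnoc m c (fun x h' => ?_) x
      have := h₂ m hw h x ((E j).incl h')
      rw [twoSidedVec, (E j).inner_vec_incl, (E j).proj_incl, zero_smul, zero_add] at this
      exact this
    -- If `w` does not end with `j`, the letter `j` can be appended, and `h' = ξ_j` recovers the
    -- vector over `w` itself.
    · have hm : (i :: (w ++ [j])).IsChain (· ≠ ·) := by
        refine (List.isChain_append (l₁ := i :: w)).2 ⟨hw, List.isChain_singleton _, ?_⟩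
        rintro a ha b hb rfl
        obtain rfl : j = a := by simpa using hb
        obtain _ | ⟨b, w⟩ := w
        · exact hs ⟨rfl, by simpa using ha⟩
        · exact hl (List.getLast?_cons_cons.symm.trans ha)
      have := h₂ w hm h x (E j).vec
      rw [twoSidedVec_eq, rightVec_vec, rightVec_vec] at this
      exact this
  refine hilbertSum_ext fun w x => ?_
  obtain ⟨w, hw⟩ := w
  by_cases hi : w.head? = some i
  · obtain _ | ⟨k, w⟩ := w
    · simp at hi
    obtain rfl : k = i := by simpa using hi
    exact hcons w hw (hleft w hw) x
  -- A word not beginning with `i` is reached by taking `h = ξ_i`.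
  · have hw' : (i :: w).IsChain (· ≠ ·) :=
      List.isChain_cons.2 ⟨fun a ha hia => hi (hia ▸ ha), hw⟩
    have := hleft w hw' (E i).vec x
    rwa [leftVec_vec] at this

/-- On two-sided vectors the operators act on different tensor factors. Only the copy of `E_i` for
`i = j` has to be supplied. -/
lemma commute_leftVariable_rightVariable (i j : ι) (S : (E i).carrier ≃ₗᵢ[ℂ] (E i).carrier)
    (T : (E j).carrier ≃ₗᵢ[ℂ] (E j).carrier)
    (h : i = j → ∀ h x, (leftVariable i S * rightVariable j T : FreeProduct E →L[ℂ] FreeProduct E)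
        (leftVec i [] (List.isChain_singleton _) h x) =
      (rightVariable j T * leftVariable i S : FreeProduct E →L[ℂ] FreeProduct E)
        (leftVec i [] (List.isChain_singleton _) h x)) :
    Commute (leftVariable i S) (rightVariable j T) := by
  refine Subtype.ext (freeProduct_ext i j h fun m hm h x h' => ?_)
  change (leftVariable i S : FreeProduct E →L[ℂ] FreeProduct E)
    ((rightVariable j T : FreeProduct E →L[ℂ] FreeProduct E) _) =
    (rightVariable j T : FreeProduct E →L[ℂ] FreeProduct E)
    ((leftVariable i S : FreeProduct E →L[ℂ] FreeProduct E) _)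
  rw [rightVariable_twoSidedVec, leftVariable_twoSidedVec, leftVariable_twoSidedVec,
    rightVariable_twoSidedVec]

lemma commute_leftVariable_rightVariable_of_ne {i j : ι} (hij : i ≠ j)
    (S : (E i).carrier ≃ₗᵢ[ℂ] (E i).carrier) (T : (E j).carrier ≃ₗᵢ[ℂ] (E j).carrier) :
    Commute (leftVariable i S) (rightVariable j T) :=
  commute_leftVariable_rightVariable i j S T fun h => (hij h).elim

lemma commute_leftVariable_rightVariable_same {i : ι}
    (S T : (E i).carrier ≃ₗᵢ[ℂ] (E i).carrier) (h : ∀ x, S (T x) = T (S x)) :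
    Commute (leftVariable i S) (rightVariable i T) := by
  refine commute_leftVariable_rightVariable i i S T fun _ y x => ?_
  change (leftVariable i S : FreeProduct E →L[ℂ] FreeProduct E)
    ((rightVariable i T : FreeProduct E →L[ℂ] FreeProduct E) _) =
    (rightVariable i T : FreeProduct E →L[ℂ] FreeProduct E)
    ((leftVariable i S : FreeProduct E →L[ℂ] FreeProduct E) _)
  rw [leftVariable_leftVec, ← rightVec_nil, ← rightVec_nil, rightVariable_rightVec,
    rightVariable_rightVec, rightVec_nil, leftVariable_leftVec, rightVec_nil, h]

end FreeProduct

/-! ### The orbit of the vacuum: alternating words -/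

section FreeProduct

variable {ι : Type} {E : ι → PointedHilbert}

/-- Makes negative powers instances of positive ones, with `S` replaced by its inverse. -/
lemma leftVariable_symm (i : ι) (S : (E i).carrier ≃ₗᵢ[ℂ] (E i).carrier) :
    leftVariable i S.symm = (leftVariable i S)⁻¹ := by
  refine eq_inv_of_mul_eq_one_left (Subtype.ext (freeProduct_ext i i (fun _ h x => ?_)
    fun m hm h x h' => ?_))
  · change (leftVariable i S.symm : FreeProduct E →L[ℂ] FreeProduct E)
      ((leftVariable i S : FreeProduct E →L[ℂ] FreeProduct E) _) = _
    rw [leftVariable_leftVec, leftVariable_leftVec, S.symm_apply_apply]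
    rfl
  · change (leftVariable i S.symm : FreeProduct E →L[ℂ] FreeProduct E)
      ((leftVariable i S : FreeProduct E →L[ℂ] FreeProduct E) _) = _
    rw [leftVariable_twoSidedVec, leftVariable_twoSidedVec, S.symm_apply_apply]
    rfl

lemma rightVariable_symm (i : ι) (T : (E i).carrier ≃ₗᵢ[ℂ] (E i).carrier) :
    rightVariable i T.symm = (rightVariable i T)⁻¹ := by
  refine eq_inv_of_mul_eq_one_left (Subtype.ext (freeProduct_ext i i (fun _ h x => ?_)
    fun m hm h x h' => ?_))
  · change (rightVariable i T.symm : FreeProduct E →L[ℂ] FreeProduct E)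
      ((rightVariable i T : FreeProduct E →L[ℂ] FreeProduct E) _) = _
    rw [← rightVec_nil, rightVariable_rightVec, rightVariable_rightVec, T.symm_apply_apply]
    rfl
  · change (rightVariable i T.symm : FreeProduct E →L[ℂ] FreeProduct E)
      ((rightVariable i T : FreeProduct E →L[ℂ] FreeProduct E) _) = _
    rw [rightVariable_twoSidedVec, rightVariable_twoSidedVec, T.symm_apply_apply]
    rfl

lemma vacuum_eq : vacuum E = wordIncl E ⟨[], List.isChain_nil⟩ (emptyTensor E) := by
  classical
  exact (summandIncl_apply _ _).symm

lemma vacuum_eq_leftVec (i : ι) :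
    vacuum E = leftVec i [] (List.isChain_singleton _) (E i).vec (emptyTensor E) := by
  rw [leftVec_vec, vacuum_eq]

lemma inner_vacuum_leftVec (i : ι) (h : (E i).carrier) :
    ⟪vacuum E, leftVec i [] (List.isChain_singleton _) h (emptyTensor E)⟫_ℂ =
      ⟪(E i).vec, h⟫_ℂ := by
  rw [leftVec, inner_add_right, inner_smul_right, ← vacuum_eq, inner_self_eq_norm_sq_to_K,
    norm_vacuum, vacuum_eq, summandIncl_inner_of_ne]
  · simp
  · simp

lemma inner_vacuum_leftVariable (i : ι) (S : (E i).carrier ≃ₗᵢ[ℂ] (E i).carrier) :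
    ⟪vacuum E, (leftVariable i S : FreeProduct E →L[ℂ] FreeProduct E) (vacuum E)⟫_ℂ =
      ⟪(E i).vec, S (E i).vec⟫_ℂ := by
  rw [← inner_vacuum_leftVec, ← leftVariable_leftVec, ← vacuum_eq_leftVec]

lemma inner_vacuum_rightVariable (i : ι) (T : (E i).carrier ≃ₗᵢ[ℂ] (E i).carrier) :
    ⟪vacuum E, (rightVariable i T : FreeProduct E →L[ℂ] FreeProduct E) (vacuum E)⟫_ℂ =
      ⟪(E i).vec, T (E i).vec⟫_ℂ := by
  rw [← inner_vacuum_leftVec, ← rightVec_nil, ← rightVariable_rightVec, rightVec_nil,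
    ← vacuum_eq_leftVec]

/-- The vacuum stays inside the copy of `E_i`, where the two operators act as `S` and `T`. -/
lemma inner_vacuum_leftVariable_rightVariable (i : ι)
    (S T : (E i).carrier ≃ₗᵢ[ℂ] (E i).carrier) :
    ⟪vacuum E, (leftVariable i S : FreeProduct E →L[ℂ] FreeProduct E)
      ((rightVariable i T : FreeProduct E →L[ℂ] FreeProduct E) (vacuum E))⟫_ℂ =
      ⟪(E i).vec, S (T (E i).vec)⟫_ℂ := by
  rw [← inner_vacuum_leftVec, ← leftVariable_leftVec, ← rightVec_nil, ← rightVariable_rightVec,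
    rightVec_nil, ← vacuum_eq_leftVec]

variable (g g' : ∀ i, (E i).Circ)

/-- The elementary tensor `g i₁ ⊗ ⋯ ⊗ g iₙ` for the word `i₁ ⋯ iₙ`. -/
def pureTensor : ∀ w : List ι, (wordSpace E w).carrier
  | [] => emptyTensor E
  | i :: w => consTensor E i w (g i) (pureTensor w)

/-- A pure tensor built from the right equals the one built from the left, so orbits of left and
right variables can be compared. -/
lemma snocTensor_pureTensor (i : ι) (w : List ι) :
    snocTensor E i w (pureTensor g w) (g i) = pureTensor g (w ++ [i]) := by
  induction w with
  | nil => exact snocTensor_nil E i (g i)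
  | cons j w ih =>
    exact (snocTensor_consTensor E j i w _ _ _).trans
      (congrArg (consTensor E j (w ++ [i]) (g j)) ih)

lemma inner_pureTensor (w : List ι) :
    ⟪pureTensor g w, pureTensor g' w⟫_ℂ = (w.map fun i => ⟪g i, g' i⟫_ℂ).prod := by
  induction w with
  | nil =>
    change ⟪(1 : ℂ), (1 : ℂ)⟫_ℂ = 1
    simp
  | cons i w ih =>
    rw [List.map_cons, List.prod_cons, ← ih]
    exact TensorProduct.inner_tmul (𝕜 := ℂ) (g i) (g' i) (pureTensor g w) (pureTensor g' w)

/-- The elementary tensor `g i₁ ⊗ ⋯ ⊗ g iₙ` as a vector of the free product. -/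
def pureVec (w : Word ι) : FreeProduct E := wordIncl E w (pureTensor g w.1)

/-- Centredness enters here: `S ξ_i` has no vacuum component, so a word not starting with `i` just
gains the letter `i`. -/
lemma leftVariable_pureVec {i : ι} {S : (E i).carrier ≃ₗᵢ[ℂ] (E i).carrier}
    (hS : S (E i).vec = (E i).incl (g i)) (w : List ι) (hw : (i :: w).IsChain (· ≠ ·)) :
    (leftVariable i S : FreeProduct E →L[ℂ] FreeProduct E) (pureVec g ⟨w, chain_tail hw⟩) =
      pureVec g ⟨i :: w, hw⟩ := by
  rw [pureVec, ← leftVec_vec, leftVariable_leftVec, hS, leftVec_incl]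
  rfl

lemma rightVariable_pureVec {i : ι} {T : (E i).carrier ≃ₗᵢ[ℂ] (E i).carrier}
    (hT : T (E i).vec = (E i).incl (g i)) (w : List ι) (hw : (w ++ [i]).IsChain (· ≠ ·)) :
    (rightVariable i T : FreeProduct E →L[ℂ] FreeProduct E) (pureVec g ⟨w, chain_init hw⟩) =
      pureVec g ⟨w ++ [i], hw⟩ := by
  rw [pureVec, ← rightVec_vec, rightVariable_rightVec, hT, rightVec_incl, snocTensor_pureTensor]
  rfl

/-- The word `i j i j ⋯ i j` of length `2 n`. -/
def altList (i j : ι) : ℕ → List ι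
  | 0 => []
  | n + 1 => i :: j :: altList i j n

/-- The form needed for right variables, which append. -/
lemma altList_succ' (i j : ι) (n : ℕ) : altList i j (n + 1) = altList i j n ++ [i] ++ [j] := by
  induction n with
  | zero => rfl
  | succ n ih => exact congrArg (fun w => i :: j :: w) ih

lemma length_altList (i j : ι) (n : ℕ) : (altList i j n).length = 2 * n := by
  induction n with
  | zero => rfl
  | succ n ih => simp [altList, ih]; ring

lemma isChain_cons_altList {i j : ι} (hij : i ≠ j) (n : ℕ) :
    (j :: altList i j n).IsChain (· ≠ ·) := by
  induction n with
  | zero => exact List.isChain_singleton _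
  | succ n ih => exact List.isChain_cons_cons.2 ⟨hij.symm, List.isChain_cons_cons.2 ⟨hij, ih⟩⟩

/-- The alternating word `i j i j ⋯ i j` of length `2 n`. -/
def altWord {i j : ι} (hij : i ≠ j) (n : ℕ) : Word ι :=
  ⟨altList i j n, chain_tail (isChain_cons_altList hij n)⟩

lemma altWord_injective {i j : ι} (hij : i ≠ j) : Function.Injective (altWord hij) := by
  intro m n h
  have := congrArg (fun w : Word ι => w.1.length) h
  simpa [altWord, length_altList] using this

/-- Nonempty words of the two kinds differ in their first letter; only the two empty words coincide.
-/
lemma altWord_ne {i j : ι} (hij : i ≠ j) (m n : ℕ) (h : m ≠ 0 ∨ n ≠ 0) :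
    altWord hij m ≠ altWord hij.symm n := by
  intro e
  have e' : altList i j m = altList j i n := congrArg Subtype.val e
  obtain _ | m := m <;> obtain _ | n := n
  · simp at h
  · simp [altList] at e'
  · simp [altList] at e'
  · simp [altList, hij] at e'

lemma inner_pureVec_of_ne {w w' : Word ι} (h : w ≠ w') : ⟪pureVec g w, pureVec g' w'⟫_ℂ = 0 :=
  summandIncl_inner_of_ne h _ _

lemma inner_pureVec_altWord {i j : ι} (hij : i ≠ j) (n : ℕ) :
    ⟪pureVec g (altWord hij n), pureVec g' (altWord hij n)⟫_ℂ =
      (⟪g i, g' i⟫_ℂ * ⟪g j, g' j⟫_ℂ) ^ n := by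
  rw [pureVec, pureVec, summandIncl_inner_self, inner_pureTensor]
  change ((altList i j n).map _).prod = _
  induction n with
  | zero => rfl
  | succ n ih =>
    rw [altList, List.map_cons, List.map_cons, List.prod_cons, List.prod_cons, ih]
    ring

lemma inner_pureVec_altWord_eq_zero {i j : ι} (hij : i ≠ j) {m n : ℕ} (h : m ≠ 0 ∨ n ≠ 0)
    (hg : ⟪g i, g' i⟫_ℂ * ⟪g j, g' j⟫_ℂ = 0) :
    ⟪pureVec g (altWord hij m), pureVec g' (altWord hij n)⟫_ℂ = 0 := by
  by_cases hmn : m = n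
  · subst hmn
    rw [inner_pureVec_altWord, hg, zero_pow (by simpa using h)]
  · exact inner_pureVec_of_ne g g' ((altWord_injective hij).ne hmn)

/-- Each factor prepends first `j`, then `i`. -/
lemma left_pow_vacuum {S : ∀ i, (E i).carrier ≃ₗᵢ[ℂ] (E i).carrier}
    (hS : ∀ i, S i (E i).vec = (E i).incl (g i)) {i j : ι} (hij : i ≠ j) (n : ℕ) :
    (((leftVariable i (S i) * leftVariable j (S j)) ^ n :
      unitary (FreeProduct E →L[ℂ] FreeProduct E)) : FreeProduct E →L[ℂ] FreeProduct E)
        (vacuum E) = pureVec g (altWord hij n) := by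
  induction n with
  | zero =>
    rw [pow_zero]
    exact vacuum_eq
  | succ n ih =>
    rw [pow_succ']
    change (leftVariable i (S i) : FreeProduct E →L[ℂ] FreeProduct E)
      ((leftVariable j (S j) : FreeProduct E →L[ℂ] FreeProduct E)
        ((((leftVariable i (S i) * leftVariable j (S j)) ^ n :
      unitary (FreeProduct E →L[ℂ] FreeProduct E)) : FreeProduct E →L[ℂ] FreeProduct E)
        (vacuum E))) = _
    rw [ih, altWord, leftVariable_pureVec g (hS j) _ (isChain_cons_altList hij n),
      leftVariable_pureVec g (hS i) _
        (chain_tail (isChain_cons_altList hij (n + 1)))]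
    rfl

/-- The product is in the order `j`, `i`, opposite to the left case: `i` is appended first, then
`j`, so the word is again `(i j)^n`. -/
lemma right_pow_vacuum {T : ∀ i, (E i).carrier ≃ₗᵢ[ℂ] (E i).carrier}
    (hT : ∀ i, T i (E i).vec = (E i).incl (g i)) {i j : ι} (hij : i ≠ j) (n : ℕ) :
    (((rightVariable j (T j) * rightVariable i (T i)) ^ n :
      unitary (FreeProduct E →L[ℂ] FreeProduct E)) : FreeProduct E →L[ℂ] FreeProduct E)
        (vacuum E) = pureVec g (altWord hij n) := by
  induction n with
  | zero =>
    rw [pow_zero]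
    exact vacuum_eq
  | succ n ih =>
    have hc : (altList i j n ++ [i] ++ [j]).IsChain (· ≠ ·) := by
      rw [← altList_succ']
      exact (altWord hij (n + 1)).2
    rw [pow_succ']
    change (rightVariable j (T j) : FreeProduct E →L[ℂ] FreeProduct E)
      ((rightVariable i (T i) : FreeProduct E →L[ℂ] FreeProduct E)
        ((((rightVariable j (T j) * rightVariable i (T i)) ^ n :
      unitary (FreeProduct E →L[ℂ] FreeProduct E)) : FreeProduct E →L[ℂ] FreeProduct E)
        (vacuum E))) = _
    rw [ih, altWord, rightVariable_pureVec g (hT i) _ (chain_init hc),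
      rightVariable_pureVec g (hT j) _ hc]
    exact congrArg (pureVec g) (Subtype.ext (altList_succ' i j n).symm)

end FreeProduct

/-! ### Mixed moments of the two products -/

section Moments

variable {ι : Type} {E : ι → PointedHilbert} {S T : ∀ i, (E i).carrier ≃ₗᵢ[ℂ] (E i).carrier}

lemma commute_product_variables (hST : ∀ i h, S i (T i h) = T i (S i h)) (i j : ι) :
    Commute (leftVariable i (S i) * leftVariable j (S j))
      (rightVariable i (T i) * rightVariable j (T j)) := by
  have key : ∀ a b, Commute (leftVariable a (S a)) (rightVariable b (T b)) := by
    intro a b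
    by_cases h : a = b
    · subst h
      exact commute_leftVariable_rightVariable_same _ _ (hST a)
    · exact commute_leftVariable_rightVariable_of_ne h _ _
  exact ((key i i).mul_right (key i j)).mul_left ((key j i).mul_right (key j j))

/-- Moves the left product to the other side, so that each product acts on the vacuum alone. -/
lemma inner_unitary_mul {H : Type*} [NormedAddCommGroup H] [InnerProductSpace ℂ H]
    [CompleteSpace H] (U V : unitary (H →L[ℂ] H)) (x y : H) :
    ⟪x, ((U * V : unitary (H →L[ℂ] H)) : H →L[ℂ] H) y⟫_ℂ =
      ⟪((U⁻¹ : unitary (H →L[ℂ] H)) : H →L[ℂ] H) x, (V : H →L[ℂ] H) y⟫_ℂ :=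
  (ContinuousLinearMap.adjoint_inner_left (U : H →L[ℂ] H) _ _).symm

lemma PointedHilbert.incl_proj_of_inner_eq_zero (F : PointedHilbert) {h : F.carrier}
    (hh : ⟪F.vec, h⟫_ℂ = 0) : F.incl (F.proj h) = h := by
  rw [F.incl_proj, hh, zero_smul, sub_zero]

lemma inner_vec_symm_eq_zero {F : PointedHilbert} {U : F.carrier ≃ₗᵢ[ℂ] F.carrier}
    (hU : ⟪F.vec, U F.vec⟫_ℂ = 0) : ⟪F.vec, U.symm F.vec⟫_ℂ = 0 := by
  rw [← U.inner_map_map, U.apply_symm_apply, ← inner_conj_symm, hU, map_zero]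

/-- The component of `U ξ` orthogonal to `ξ`. -/
def circVec (U : ∀ i, (E i).carrier ≃ₗᵢ[ℂ] (E i).carrier) (i : ι) : (E i).Circ :=
  (E i).proj (U i (E i).vec)

lemma incl_circVec {U : ∀ i, (E i).carrier ≃ₗᵢ[ℂ] (E i).carrier}
    (hU : ∀ i, ⟪(E i).vec, U i (E i).vec⟫_ℂ = 0) (i : ι) :
    U i (E i).vec = (E i).incl (circVec U i) :=
  ((E i).incl_proj_of_inner_eq_zero (hU i)).symm

lemma inner_circVec {U V : ∀ i, (E i).carrier ≃ₗᵢ[ℂ] (E i).carrier}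
    (hU : ∀ i, ⟪(E i).vec, U i (E i).vec⟫_ℂ = 0)
    (hV : ∀ i, ⟪(E i).vec, V i (E i).vec⟫_ℂ = 0) (i : ι) :
    ⟪circVec U i, circVec V i⟫_ℂ = ⟪U i (E i).vec, V i (E i).vec⟫_ℂ := by
  rw [incl_circVec hU, incl_circVec hV, LinearIsometry.inner_map_map]

/-- Inversion reverses the order of the factors, so the word is `(j i)^n`. -/
lemma left_inv_pow_vacuum (hS : ∀ i, ⟪(E i).vec, S i (E i).vec⟫_ℂ = 0)
    {i j : ι} (hij : i ≠ j) (n : ℕ) :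
    ((((leftVariable i (S i) * leftVariable j (S j)) ^ n)⁻¹ :
      unitary (FreeProduct E →L[ℂ] FreeProduct E)) : FreeProduct E →L[ℂ] FreeProduct E)
        (vacuum E) = pureVec (circVec fun i => (S i).symm) (altWord hij.symm n) := by
  rw [← inv_pow, mul_inv_rev, ← leftVariable_symm, ← leftVariable_symm]
  exact left_pow_vacuum (S := fun i => (S i).symm) _
    (incl_circVec (fun i => inner_vec_symm_eq_zero (hS i))) hij.symm n

lemma right_inv_pow_vacuum (hT : ∀ i, ⟪(E i).vec, T i (E i).vec⟫_ℂ = 0)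
    {i j : ι} (hij : i ≠ j) (n : ℕ) :
    ((((rightVariable i (T i) * rightVariable j (T j)) ^ n)⁻¹ :
      unitary (FreeProduct E →L[ℂ] FreeProduct E)) : FreeProduct E →L[ℂ] FreeProduct E)
        (vacuum E) = pureVec (circVec fun i => (T i).symm) (altWord hij n) := by
  rw [← inv_pow, mul_inv_rev, ← rightVariable_symm, ← rightVariable_symm]
  exact right_pow_vacuum (T := fun i => (T i).symm) _
    (incl_circVec (fun i => inner_vec_symm_eq_zero (hT i))) hij n

/-- Both vectors lie over the word `j i`, and each letter contributes `⟨S⁻¹ξ, Tξ⟩ = ⟨ξ, STξ⟩`. -/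
lemma inner_vacuum_mul (hS : ∀ i, ⟪(E i).vec, S i (E i).vec⟫_ℂ = 0)
    (hT : ∀ i, ⟪(E i).vec, T i (E i).vec⟫_ℂ = 0) {i j : ι} (hij : i ≠ j) :
    ⟪vacuum E, (((leftVariable i (S i) * leftVariable j (S j)) *
      (rightVariable i (T i) * rightVariable j (T j)) :
      unitary (FreeProduct E →L[ℂ] FreeProduct E)) : FreeProduct E →L[ℂ] FreeProduct E)
        (vacuum E)⟫_ℂ =
      ⟪(E i).vec, S i (T i (E i).vec)⟫_ℂ * ⟪(E j).vec, S j (T j (E j).vec)⟫_ℂ := by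
  have h1 := left_inv_pow_vacuum hS hij 1
  have h2 := right_pow_vacuum (T := T) _ (incl_circVec hT) hij.symm 1
  rw [pow_one] at h1 h2
  rw [inner_unitary_mul, h1, h2, inner_pureVec_altWord, pow_one,
    inner_circVec (fun i => inner_vec_symm_eq_zero (hS i)) hT,
    inner_circVec (fun i => inner_vec_symm_eq_zero (hS i)) hT, mul_comm,
    ← (S i).inner_map_map, ← (S j).inner_map_map, (S i).apply_symm_apply, (S j).apply_symm_apply]

/-- Exponents of equal sign give tensors over words of the same kind, where the vanishing factor
enters; exponents of opposite sign give words of different kinds. -/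
lemma inner_vacuum_zpow_mul_zpow_eq_zero (hS : ∀ i, ⟪(E i).vec, S i (E i).vec⟫_ℂ = 0)
    (hT : ∀ i, ⟪(E i).vec, T i (E i).vec⟫_ℂ = 0)
    (hST : ∀ i h, S i (T i h) = T i (S i h)) {i j : ι}
    (hij : i ≠ j)
    (h0 : ⟪(E i).vec, S i (T i (E i).vec)⟫_ℂ = 0 ∨ ⟪(E j).vec, S j (T j (E j).vec)⟫_ℂ = 0)
    {m n : ℤ} (hmn : m ≠ 0 ∨ n ≠ 0) :
    ⟪vacuum E, (((leftVariable i (S i) * leftVariable j (S j)) ^ m *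
      (rightVariable i (T i) * rightVariable j (T j)) ^ n :
      unitary (FreeProduct E →L[ℂ] FreeProduct E)) : FreeProduct E →L[ℂ] FreeProduct E)
        (vacuum E)⟫_ℂ = 0 := by
  have hS' : ∀ i, ⟪(E i).vec, (S i).symm (E i).vec⟫_ℂ = 0 := fun i =>
    inner_vec_symm_eq_zero (hS i)
  have hT' : ∀ i, ⟪(E i).vec, (T i).symm (E i).vec⟫_ℂ = 0 := fun i =>
    inner_vec_symm_eq_zero (hT i)
  have c1 : ∀ a, ⟪circVec (fun i => (S i).symm) a, circVec T a⟫_ℂ =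
      ⟪(E a).vec, S a (T a (E a).vec)⟫_ℂ := by
    intro a
    rw [inner_circVec hS' hT, ← (S a).inner_map_map, (S a).apply_symm_apply]
  -- For negative exponents `⟨Sξ, T⁻¹ξ⟩` is the conjugate of `⟨ξ, TSξ⟩`; commutation of `S` and `T`
  -- turns this into the same mixed moment.
  have c2 : ∀ a, ⟪circVec S a, circVec (fun i => (T i).symm) a⟫_ℂ =
      starRingEnd ℂ ⟪(E a).vec, S a (T a (E a).vec)⟫_ℂ := by
    intro a
    rw [inner_circVec hS hT', ← (T a).inner_map_map, (T a).apply_symm_apply, inner_conj_symm, hST]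
  rw [inner_unitary_mul]
  obtain ⟨a, rfl | rfl⟩ := m.eq_nat_or_neg <;> obtain ⟨b, rfl | rfl⟩ := n.eq_nat_or_neg <;>
    simp only [zpow_neg, zpow_natCast, inv_inv, ne_eq, neg_eq_zero, Nat.cast_eq_zero] at hmn ⊢
  · rw [left_inv_pow_vacuum hS hij, right_pow_vacuum (T := T) _ (incl_circVec hT) hij.symm]
    refine inner_pureVec_altWord_eq_zero _ _ hij.symm hmn ?_
    rw [c1, c1]
    rcases h0 with h0 | h0 <;> rw [h0] <;> simp
  · rw [left_inv_pow_vacuum hS hij, right_inv_pow_vacuum hT hij]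
    exact inner_pureVec_of_ne _ _ (altWord_ne hij.symm _ _ hmn)
  · rw [left_pow_vacuum (S := S) _ (incl_circVec hS) hij,
      right_pow_vacuum (T := T) _ (incl_circVec hT) hij.symm]
    exact inner_pureVec_of_ne _ _ (altWord_ne hij _ _ hmn)
  · rw [left_pow_vacuum (S := S) _ (incl_circVec hS) hij, right_inv_pow_vacuum hT hij]
    refine inner_pureVec_altWord_eq_zero _ _ hij hmn ?_
    rw [c2, c2]
    rcases h0 with h0 | h0 <;> rw [h0] <;> simp

end Moments

/-! ### Trigonometric moments on the torus -/

section Monomials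

/-- The first coordinate function of the torus. -/
def coordFst : unitary C(Torus, ℂ) :=
  ⟨⟨fun x => (x.1 : ℂ), by fun_prop⟩, by
    constructor <;> ext x <;> simp [Complex.conj_mul', Complex.mul_conj', Circle.norm_coe]⟩

/-- The second coordinate function of the torus. -/
def coordSnd : unitary C(Torus, ℂ) :=
  ⟨⟨fun x => (x.2 : ℂ), by fun_prop⟩, by
    constructor <;> ext x <;> simp [Complex.conj_mul', Complex.mul_conj', Circle.norm_coe]⟩

/-- The function `(z, w) ↦ z ^ m * w ^ n` on the torus. -/
def torusMonomial (m n : ℤ) : C(Torus, ℂ) :=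
  ((coordFst ^ m * coordSnd ^ n : unitary C(Torus, ℂ)) : C(Torus, ℂ))

/-- Negative powers live in the unitary group, so the homomorphism is first restricted to unitaries.
-/
lemma starAlgHom_unitary_zpow {A B : Type*} [CStarAlgebra A] [CStarAlgebra B] (f : A →⋆ₐ[ℂ] B)
    (u v : unitary A) (u' v' : unitary B) (hu : f u = u') (hv : f v = v') (m n : ℤ) :
    f ((u ^ m * v ^ n : unitary A) : A) = ((u' ^ m * v' ^ n : unitary B) : B) := by
  let F : unitary A →⋆* unitary B := Unitary.map ⟨(f : A →* B), map_star f⟩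
  have h1 : F u = u' := Subtype.ext hu
  have h2 : F v = v' := Subtype.ext hv
  rw [← h1, ← h2, ← map_zpow, ← map_zpow, ← map_mul]
  rfl

lemma torusMonomial_apply (m n : ℤ) (x : Torus) :
    torusMonomial m n x = (x.1 : ℂ) ^ m * (x.2 : ℂ) ^ n := by
  let F : unitary C(Torus, ℂ) →⋆* unitary ℂ :=
    Unitary.map ⟨(ContinuousMap.evalStarAlgHom ℂ ℂ x : C(Torus, ℂ) →* ℂ),
      map_star (ContinuousMap.evalStarAlgHom ℂ ℂ x)⟩
  have h := starAlgHom_unitary_zpow (ContinuousMap.evalStarAlgHom ℂ ℂ x) coordFst coordSnd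
    (F coordFst) (F coordSnd) rfl rfl m n
  refine h.trans ?_
  rw [Submonoid.coe_mul, Unitary.coe_zpow, Unitary.coe_zpow]
  rfl

lemma torusMonomial_mul (m n m' n' : ℤ) :
    torusMonomial m n * torusMonomial m' n' = torusMonomial (m + m') (n + n') := by
  ext x
  simp only [ContinuousMap.mul_apply, torusMonomial_apply, zpow_add₀ x.1.coe_ne_zero,
    zpow_add₀ x.2.coe_ne_zero]
  ring

lemma torusMonomial_zero : torusMonomial 0 0 = 1 := by
  ext x
  simp [torusMonomial_apply]

lemma star_torusMonomial (m n : ℤ) : star (torusMonomial m n) = torusMonomial (-m) (-n) := by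
  ext x
  simp only [ContinuousMap.star_apply, torusMonomial_apply, star_mul', RCLike.star_def, map_zpow₀,
    ← Circle.coe_inv_eq_conj, Circle.coe_inv, inv_zpow', zpow_neg]

/-- Probability measures on the torus with the same moments are equal. -/
lemma eq_of_integral_torusMonomial_eq {μ ν : ProbabilityMeasure Torus}
    (h : ∀ m n, ∫ x, torusMonomial m n x ∂(μ : Measure Torus) =
      ∫ x, torusMonomial m n x ∂(ν : Measure Torus)) : μ = ν := by
  let b : ℤ × ℤ → BoundedContinuousFunction Torus ℂ := fun p =>
    BoundedContinuousFunction.mkOfCompact (torusMonomial p.1 p.2)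
  have b_mul : ∀ p q, b p * b q = b (p + q) := fun p q =>
    BoundedContinuousFunction.ext fun x => DFunLike.congr_fun (torusMonomial_mul _ _ _ _) x
  have b_one : b 0 = 1 :=
    BoundedContinuousFunction.ext fun x => DFunLike.congr_fun torusMonomial_zero x
  have b_star : ∀ p, star (b p) = b (-p) := fun p =>
    BoundedContinuousFunction.ext fun x => DFunLike.congr_fun (star_torusMonomial _ _) x
  let A : StarSubalgebra ℂ (BoundedContinuousFunction Torus ℂ) :=
    { toSubalgebra := Algebra.adjoin ℂ (Set.range b)
      star_mem' := by
        change Algebra.adjoin ℂ (Set.range b) ≤ star (Algebra.adjoin ℂ (Set.range b))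
        refine Algebra.adjoin_le ?_
        rintro - ⟨p, rfl⟩
        refine Algebra.subset_adjoin ⟨-p, ?_⟩
        exact (b_star p).symm }
  -- The monomials are closed under products and contain `1`, so the algebra they generate is just
  -- their span, and linearity of the integral suffices.
  have hA : Subalgebra.toSubmodule A.toSubalgebra = Submodule.span ℂ (Set.range b) := by
    refine Algebra.adjoin_eq_span_of_subset ℂ (Set.Subset.trans ?_ Submodule.subset_span)
    intro x hx
    refine Submonoid.closure_induction (fun _ => id) ⟨0, b_one⟩ ?_ hx
    rintro - - - - ⟨p, rfl⟩ ⟨q, rfl⟩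
    exact ⟨p + q, (b_mul p q).symm⟩
  refine Subtype.ext (ext_of_forall_mem_subalgebra_integral_eq_of_polish (𝕜 := ℂ)
    (P := (μ : Measure Torus)) (P' := (ν : Measure Torus)) (A := A) ?_ ?_)
  · intro x y hxy
    have key : ∀ p : ℤ × ℤ, torusMonomial p.1 p.2 x ≠ torusMonomial p.1 p.2 y →
        ∃ f ∈ (fun f : C(Torus, ℂ) => (f : Torus → ℂ)) ''
          (A.map (BoundedContinuousFunction.toContinuousMapStarₐ ℂ) : Set C(Torus, ℂ)),
          f x ≠ f y := fun p hp =>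
      ⟨_, ⟨_, ⟨b p, Algebra.subset_adjoin ⟨p, rfl⟩, rfl⟩, rfl⟩, hp⟩
    -- The two coordinate functions already separate points.
    by_cases h1 : x.1 = y.1
    · refine key (0, 1) fun e => hxy (Prod.ext h1 ?_)
      exact Circle.ext (by simpa [torusMonomial_apply] using e)
    · refine key (1, 0) fun e => h1 ?_
      exact Circle.ext (by simpa [torusMonomial_apply] using e)
  · intro g hg
    have hg' : g ∈ Submodule.span ℂ (Set.range b) := hA.le hg
    induction hg' using Submodule.span_induction with
    | mem x hx =>
      obtain ⟨p, rfl⟩ := hx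
      exact h p.1 p.2
    | zero => simp
    | add x y hx hy h1 h2 =>
      simp only [BoundedContinuousFunction.coe_add, Pi.add_apply]
      rw [integral_add (x.integrable _) (y.integrable _),
        integral_add (x.integrable _) (y.integrable _), h1 (hA.ge hx), h2 (hA.ge hy)]
    | smul a x hx h1 =>
      simp only [BoundedContinuousFunction.coe_smul]
      rw [integral_smul, integral_smul, h1 (hA.ge hx)]

lemma integral_arcLength_zpow {n : ℤ} (hn : n ≠ 0) :
    ∫ z : Circle, (z : ℂ) ^ n ∂arcLength = 0 := by
  have hc : Continuous fun z : Circle => (z : ℂ) ^ n := by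
    have : (fun z : Circle => (z : ℂ) ^ n) = fun z : Circle => ((z ^ n : Circle) : ℂ) := by
      ext z; exact (Circle.coe_zpow z n).symm
    rw [this]
    exact (by fun_prop : Continuous fun z : Circle => (z : ℂ)).comp (continuous_zpow n)
  rw [arcLength, integral_smul_measure, integral_map (by fun_prop)
    hc.aestronglyMeasurable, ← intervalIntegral.integral_of_le (by linarith [Real.pi_pos])]
  have hn' : (n : ℂ) * Complex.I ≠ 0 := mul_ne_zero (by exact_mod_cast hn) Complex.I_ne_zero
  have e : ∀ θ : ℝ, (Circle.exp θ : ℂ) ^ n = Complex.exp (n * Complex.I * θ) := by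
    intro θ
    rw [Circle.coe_exp, ← Complex.exp_int_mul]
    ring_nf
  simp only [e]
  rw [integral_exp_mul_complex hn']
  -- The primitive of `exp (i n θ)` takes equal values at `±π`, by periodicity.
  have : Complex.exp (n * Complex.I * (Real.pi : ℝ)) =
      Complex.exp (n * Complex.I * ((-Real.pi : ℝ) : ℂ)) := by
    rw [Complex.exp_eq_exp_iff_exists_int]
    refine ⟨n, ?_⟩
    push_cast
    ring
  rw [this, sub_self, zero_div, smul_zero]

lemma integral_uniform_torusMonomial {m n : ℤ} (h : m ≠ 0 ∨ n ≠ 0) :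
    ∫ x, torusMonomial m n x ∂(uniform : Measure Torus) = 0 := by
  simp only [torusMonomial_apply]
  refine (integral_prod_mul (μ := arcLength) (ν := arcLength) (fun z : Circle => (z : ℂ) ^ m)
    (fun z : Circle => (z : ℂ) ^ n)).trans ?_
  rcases h with h | h <;> simp [integral_arcLength_zpow h]

/-- A probability measure on the torus is the uniform measure if and only if its nontrivial moments
vanish. -/
lemma eq_uniform_iff {μ : ProbabilityMeasure Torus} : μ = uniform ↔
    ∀ m n : ℤ, m ≠ 0 ∨ n ≠ 0 → ∫ x, torusMonomial m n x ∂(μ : Measure Torus) = 0 := by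
  constructor
  · rintro rfl m n h
    exact integral_uniform_torusMonomial h
  · refine fun H => eq_of_integral_torusMonomial_eq fun m n => ?_
    by_cases h : m ≠ 0 ∨ n ≠ 0
    · rw [H m n h, integral_uniform_torusMonomial h]
    · push Not at h
      simp [h.1, h.2, torusMonomial_zero]

end Monomials

/-! ### Moments of the distribution of a commuting pair -/

section Distribution

variable {A : Type*} [CStarAlgebra A]

/-- A coordinate function composed with `gelfandPoint` is the Gelfand transform of `u` or `v`, which
the inverse transform undoes. -/
lemma commFunctionalCalculus_coord {B : Type*} [CommCStarAlgebra B] (u v : unitary B) :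
    commFunctionalCalculus u v coordFst = u ∧ commFunctionalCalculus u v coordSnd = v :=
  ⟨(gelfandStarTransform B).symm_apply_apply (u : B),
    (gelfandStarTransform B).symm_apply_apply (v : B)⟩

lemma functionalCalculus_coord {u v : unitary A} (h : Commute u v) :
    functionalCalculus h coordFst = u ∧ functionalCalculus h coordSnd = v := by
  let := generatedCommCStarAlgebra h
  have key := commFunctionalCalculus_coord (B := generatedAlgebra u v)
  exact ⟨congrArg (generatedAlgebra u v).subtype (key _ _).1,
    congrArg (generatedAlgebra u v).subtype (key _ _).2⟩

lemma functionalCalculus_torusMonomial {u v : unitary A} (h : Commute u v) (m n : ℤ) :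
    functionalCalculus h (torusMonomial m n) = ((u ^ m * v ^ n : unitary A) : A) :=
  starAlgHom_unitary_zpow _ _ _ _ _ (functionalCalculus_coord h).1 (functionalCalculus_coord h).2
    m n

/-- A real function on the torus as a complex function. -/
def complexify (f : C(Torus, ℝ)) : C(Torus, ℂ) :=
  ContinuousMap.comp ⟨Complex.ofReal, Complex.continuous_ofReal⟩ f

/-- Positivity of a state is only given on `star a * a`; the square root of `f` supplies `a`. -/
lemma state_complexify_nonneg (φ : State A) {u v : unitary A} (h : Commute u v) {f : C(Torus, ℝ)}
    (hf : 0 ≤ f) : 0 ≤ φ (functionalCalculus h (complexify f)) := by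
  let g : C(Torus, ℂ) := ⟨fun x => (Real.sqrt (f x) : ℂ), by fun_prop⟩
  have hg : complexify f = star g * g := by
    ext x
    have := Real.mul_self_sqrt (hf x)
    simp only [complexify, ContinuousMap.comp_apply, ContinuousMap.coe_mk, ContinuousMap.mul_apply,
      ContinuousMap.star_apply, RCLike.star_def, Complex.conj_ofReal, g]
    exact_mod_cast this.symm
  rw [hg, map_mul, map_star]
  exact φ.map_nonneg _

/-- Needed because `lawFunctional` keeps only the real part. A real function is a difference of two
nonnegative ones, on which the state is real. -/
lemma state_complexify_im (φ : State A) {u v : unitary A} (h : Commute u v) (f : C(Torus, ℝ)) :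
    (φ (functionalCalculus h (complexify f))).im = 0 := by
  have h1 := state_complexify_nonneg φ h (f := f ⊔ 0) le_sup_right
  have h2 := state_complexify_nonneg φ h (f := (-f) ⊔ 0) le_sup_right
  have e : complexify f = complexify (f ⊔ 0) - complexify ((-f) ⊔ 0) := by
    ext x
    simp only [complexify, ContinuousMap.comp_apply, ContinuousMap.coe_mk, ContinuousMap.sub_apply,
      ContinuousMap.sup_apply, ContinuousMap.neg_apply, ContinuousMap.zero_apply]
    rw [← Complex.ofReal_sub]
    congr 1
    rcases le_total (f x) 0 with hx | hx
    · simp [hx]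
    · simp [hx]
  rw [e, map_sub, map_sub, Complex.sub_im, ← (Complex.le_def.1 h1).2, ← (Complex.le_def.1 h2).2,
    sub_self]

lemma integral_distribution_complexify (φ : State A) {u v : unitary A} (h : Commute u v)
    (f : C(Torus, ℝ)) :
    ((∫ x, f x ∂(distribution φ u v : Measure Torus) : ℝ) : ℂ) =
      φ (functionalCalculus h (complexify f)) := by
  have h1 : ∫ x, f x ∂(distribution φ u v : Measure Torus) =
      (φ (functionalCalculus h (complexify f))).re := by
    rw [distribution, dif_pos h]
    exact RealRMK.integral_rieszMeasure (lawFunctional φ h)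
      (CompactlySupportedContinuousMap.continuousMapEquiv f)
  exact Complex.ext (by simpa using h1) (by simp [state_complexify_im])

/-- The defining property of the distribution of a pair of commuting unitaries. -/
lemma integral_distribution (φ : State A) {u v : unitary A} (h : Commute u v) (f : C(Torus, ℂ)) :
    ∫ x, f x ∂(distribution φ u v : Measure Torus) = φ (functionalCalculus h f) := by
  let a : C(Torus, ℝ) := ⟨fun x => (f x).re, by fun_prop⟩
  let b : C(Torus, ℝ) := ⟨fun x => (f x).im, by fun_prop⟩
  have e : f = complexify a + Complex.I • complexify b := by
    ext x
    change f x = ((f x).re : ℂ) + Complex.I * ((f x).im : ℂ)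
    rw [mul_comm]
    exact (Complex.re_add_im (f x)).symm
  have hf : Integrable f (distribution φ u v : Measure Torus) :=
    (BoundedContinuousFunction.mkOfCompact f).integrable _
  rw [← integral_re_add_im hf]
  conv_rhs => rw [e, map_add, map_smul, map_add, map_smul, smul_eq_mul,
    ← integral_distribution_complexify, ← integral_distribution_complexify, mul_comm]
  rfl

lemma integral_distribution_torusMonomial (φ : State A) {u v : unitary A} (h : Commute u v)
    (m n : ℤ) : ∫ x, torusMonomial m n x ∂(distribution φ u v : Measure Torus) =
      φ ((u ^ m * v ^ n : unitary A) : A) := by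
  rw [integral_distribution φ h, functionalCalculus_torusMonomial]

end Distribution

/-! ### The convolution in terms of moments -/

section Convolution

lemma coeFn_mulIsometry (μ : ProbabilityMeasure Torus) (g : Torus → Circle) (hg : Measurable g)
    (f : Lp ℂ 2 (μ : Measure Torus)) :
    (mulIsometry μ g hg f : Torus → ℂ) =ᵐ[(μ : Measure Torus)]
      fun x => (g x : ℂ) * f x :=
  (memLp_circle_mul μ hg f).coeFn_toLp

lemma mulUnitary_comm (μ : ProbabilityMeasure Torus) {g g' : Torus → Circle} (hg : Measurable g)
    (hg' : Measurable g') (f : (l2 μ).carrier) :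
    mulUnitary μ g hg (mulUnitary μ g' hg' f) = mulUnitary μ g' hg' (mulUnitary μ g hg f) := by
  refine Lp.ext ?_
  filter_upwards [coeFn_mulIsometry μ g hg (mulIsometry μ g' hg' f), coeFn_mulIsometry μ g' hg' f,
    coeFn_mulIsometry μ g' hg' (mulIsometry μ g hg f), coeFn_mulIsometry μ g hg f] with x h1 h2 h3 h4
  exact h1.trans ((congrArg _ h2).trans ((mul_left_comm _ _ _).trans
    ((congrArg _ h4.symm).trans h3.symm)))

lemma inner_l2_vec (μ : ProbabilityMeasure Torus) (f : Lp ℂ 2 (μ : Measure Torus)) :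
    ⟪(l2 μ).vec, (f : (l2 μ).carrier)⟫_ℂ = ∫ x, f x ∂(μ : Measure Torus) := by
  refine (L2.inner_def (𝕜 := ℂ) (Lp.const 2 (μ : Measure Torus) (1 : ℂ)) f).trans
    (integral_congr_ae ?_)
  filter_upwards [Lp.coeFn_const 2 (μ : Measure Torus) (1 : ℂ)] with x hx
  rw [hx]
  simp

lemma inner_l2_mulUnitary (μ : ProbabilityMeasure Torus) (g : Torus → Circle) (hg : Measurable g) :
    ⟪(l2 μ).vec, mulUnitary μ g hg (l2 μ).vec⟫_ℂ = ∫ x, (g x : ℂ) ∂(μ : Measure Torus) := by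
  refine (inner_l2_vec μ _).trans (integral_congr_ae ?_)
  filter_upwards [coeFn_mulIsometry μ g hg (l2 μ).vec,
    Lp.coeFn_const 2 (μ : Measure Torus) (1 : ℂ)] with x h1 h2
  exact h1.trans ((congrArg _ h2).trans (mul_one _))

lemma inner_l2_mulUnitary_mulUnitary (μ : ProbabilityMeasure Torus) (g g' : Torus → Circle)
    (hg : Measurable g) (hg' : Measurable g') :
    ⟪(l2 μ).vec, mulUnitary μ g hg (mulUnitary μ g' hg' (l2 μ).vec)⟫_ℂ =
      ∫ x, (g x : ℂ) * g' x ∂(μ : Measure Torus) := by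
  refine (inner_l2_vec μ _).trans (integral_congr_ae ?_)
  filter_upwards [coeFn_mulIsometry μ g hg (mulIsometry μ g' hg' (l2 μ).vec),
    coeFn_mulIsometry μ g' hg' (l2 μ).vec,
    Lp.coeFn_const 2 (μ : Measure Torus) (1 : ℂ)] with x h1 h2 h3
  exact h1.trans (congrArg _ (h2.trans ((congrArg _ h3).trans (mul_one _))))

variable (μ : Fin 2 → ProbabilityMeasure Torus) (i : Fin 2)

lemma vacuumState_apply
    (X : FreeProduct (fun i => l2 (μ i)) →L[ℂ] FreeProduct (fun i => l2 (μ i))) :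
    vacuumState μ X = ⟪vacuum fun i => l2 (μ i), X (vacuum fun i => l2 (μ i))⟫_ℂ := rfl

/-- Ensures that `distribution` in the convolution is the actual law and not its default value. -/
lemma commute_leftU_rightV :
    Commute (leftU μ 0 * leftU μ 1) (rightV μ 0 * rightV μ 1) :=
  commute_product_variables (E := fun i => l2 (μ i))
    (S := fun i => mulUnitary (μ i) Prod.fst measurable_fst)
    (T := fun i => mulUnitary (μ i) Prod.snd measurable_snd)
    (fun _ h => mulUnitary_comm _ _ _ h) 0 1

lemma inner_l2_mulUnitary_fst :
    ⟪(l2 (μ i)).vec, mulUnitary (μ i) Prod.fst measurable_fst (l2 (μ i)).vec⟫_ℂ =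
      ∫ x, torusMonomial 1 0 x ∂(μ i : Measure Torus) := by
  rw [inner_l2_mulUnitary]
  simp [torusMonomial_apply]

lemma inner_l2_mulUnitary_snd :
    ⟪(l2 (μ i)).vec, mulUnitary (μ i) Prod.snd measurable_snd (l2 (μ i)).vec⟫_ℂ =
      ∫ x, torusMonomial 0 1 x ∂(μ i : Measure Torus) := by
  rw [inner_l2_mulUnitary]
  simp [torusMonomial_apply]

lemma inner_l2_mulUnitary_fst_snd :
    ⟪(l2 (μ i)).vec, mulUnitary (μ i) Prod.fst measurable_fst
        (mulUnitary (μ i) Prod.snd measurable_snd (l2 (μ i)).vec)⟫_ℂ =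
      ∫ x, torusMonomial 1 1 x ∂(μ i : Measure Torus) := by
  rw [inner_l2_mulUnitary_mulUnitary]
  simp [torusMonomial_apply]

lemma vacuumState_leftU : vacuumState μ (leftU μ i) =
    ∫ x, torusMonomial 1 0 x ∂(μ i : Measure Torus) :=
  (inner_vacuum_leftVariable (E := fun i => l2 (μ i)) i _).trans (inner_l2_mulUnitary_fst μ i)

lemma vacuumState_rightV : vacuumState μ (rightV μ i) =
    ∫ x, torusMonomial 0 1 x ∂(μ i : Measure Torus) :=
  (inner_vacuum_rightVariable (E := fun i => l2 (μ i)) i _).trans (inner_l2_mulUnitary_snd μ i)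

lemma vacuumState_leftU_mul_rightV : vacuumState μ (leftU μ i * rightV μ i) =
    ∫ x, torusMonomial 1 1 x ∂(μ i : Measure Torus) := by
  rw [vacuumState_apply, mul_apply_eq_comp]
  exact (inner_vacuum_leftVariable_rightVariable (E := fun i => l2 (μ i)) i _ _).trans
    (inner_l2_mulUnitary_fst_snd μ i)

lemma vacuumState_mul
    (h : ∀ i, ∫ x, torusMonomial 1 0 x ∂(μ i : Measure Torus) = 0)
    (h' : ∀ i, ∫ x, torusMonomial 0 1 x ∂(μ i : Measure Torus) = 0) :
    vacuumState μ ((leftU μ 0 * leftU μ 1 * (rightV μ 0 * rightV μ 1) : unitary _) :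
      FreeProduct (fun i => l2 (μ i)) →L[ℂ] FreeProduct (fun i => l2 (μ i))) =
      (∫ x, torusMonomial 1 1 x ∂(μ 0 : Measure Torus)) *
        ∫ x, torusMonomial 1 1 x ∂(μ 1 : Measure Torus) := by
  rw [vacuumState_apply, ← inner_l2_mulUnitary_fst_snd, ← inner_l2_mulUnitary_fst_snd]
  exact inner_vacuum_mul (E := fun i => l2 (μ i))
    (S := fun i => mulUnitary (μ i) Prod.fst measurable_fst)
    (T := fun i => mulUnitary (μ i) Prod.snd measurable_snd)
    (fun i => (inner_l2_mulUnitary_fst μ i).trans (h i))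
    (fun i => (inner_l2_mulUnitary_snd μ i).trans (h' i)) zero_ne_one

lemma vacuumState_zpow_mul_zpow_eq_zero
    (h : ∀ i, ∫ x, torusMonomial 1 0 x ∂(μ i : Measure Torus) = 0)
    (h' : ∀ i, ∫ x, torusMonomial 0 1 x ∂(μ i : Measure Torus) = 0)
    (h0 : ∫ x, torusMonomial 1 1 x ∂(μ 0 : Measure Torus) = 0 ∨
      ∫ x, torusMonomial 1 1 x ∂(μ 1 : Measure Torus) = 0)
    {m n : ℤ} (hmn : m ≠ 0 ∨ n ≠ 0) :
    vacuumState μ (((leftU μ 0 * leftU μ 1) ^ m * (rightV μ 0 * rightV μ 1) ^ n : unitary _) :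
      FreeProduct (fun i => l2 (μ i)) →L[ℂ] FreeProduct (fun i => l2 (μ i))) = 0 := by
  rw [← inner_l2_mulUnitary_fst_snd, ← inner_l2_mulUnitary_fst_snd] at h0
  rw [vacuumState_apply]
  exact inner_vacuum_zpow_mul_zpow_eq_zero (E := fun i => l2 (μ i))
    (S := fun i => mulUnitary (μ i) Prod.fst measurable_fst)
    (T := fun i => mulUnitary (μ i) Prod.snd measurable_snd)
    (fun i => (inner_l2_mulUnitary_fst μ i).trans (h i))
    (fun i => (inner_l2_mulUnitary_snd μ i).trans (h' i))
    (fun _ h => mulUnitary_comm _ _ _ h) zero_ne_one h0 hmn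

/-- The moment `(1, 1)` is the product of the two mixed moments, so it alone gives the forward
direction. -/
lemma distribution_eq_uniform_iff
    (h : ∀ i, ∫ x, torusMonomial 1 0 x ∂(μ i : Measure Torus) = 0)
    (h' : ∀ i, ∫ x, torusMonomial 0 1 x ∂(μ i : Measure Torus) = 0) :
    distribution (vacuumState μ) (leftU μ 0 * leftU μ 1) (rightV μ 0 * rightV μ 1) = uniform ↔
      ∫ x, torusMonomial 1 1 x ∂(μ 0 : Measure Torus) = 0 ∨
        ∫ x, torusMonomial 1 1 x ∂(μ 1 : Measure Torus) = 0 := by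
  rw [eq_uniform_iff]
  constructor
  · intro H
    have := H 1 1 (by simp)
    rw [integral_distribution_torusMonomial _ (commute_leftU_rightV μ), zpow_one, zpow_one,
      vacuumState_mul μ h h'] at this
    exact mul_eq_zero.1 this
  · intro H m n hmn
    rw [integral_distribution_torusMonomial _ (commute_leftU_rightV μ)]
    exact vacuumState_zpow_mul_zpow_eq_zero μ h h' H hmn

/-- For centred marginals, the bi-free convolution is uniform if and only if one of the mixed first
moments vanishes. -/
lemma convolution_eq_uniform_iff (μ₁ μ₂ : ProbabilityMeasure Torus)
    (h₁ : ∫ x, torusMonomial 1 0 x ∂(μ₁ : Measure Torus) = 0)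
    (h₁' : ∫ x, torusMonomial 0 1 x ∂(μ₁ : Measure Torus) = 0)
    (h₂ : ∫ x, torusMonomial 1 0 x ∂(μ₂ : Measure Torus) = 0)
    (h₂' : ∫ x, torusMonomial 0 1 x ∂(μ₂ : Measure Torus) = 0) :
    convolution μ₁ μ₂ = uniform ↔ ∫ x, torusMonomial 1 1 x ∂(μ₁ : Measure Torus) = 0 ∨
      ∫ x, torusMonomial 1 1 x ∂(μ₂ : Measure Torus) = 0 :=
  distribution_eq_uniform_iff ![μ₁, μ₂] (Fin.forall_fin_two.2 ⟨h₁, h₂⟩)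
    (Fin.forall_fin_two.2 ⟨h₁', h₂'⟩)

end Convolution

end BiFree

end

/-! ### The proposition -/

theorem proposition2p3 :
    -- the canonical bi-free pairs `(u_i, v_i)` with distributions `μ₁`, `μ₂`
    (∀ μ₁ μ₂ : MeasureTheory.ProbabilityMeasure BiFree.Torus,
      (∀ i, BiFree.vacuumState ![μ₁, μ₂] (BiFree.leftU ![μ₁, μ₂] i) = 0 ∧
        BiFree.vacuumState ![μ₁, μ₂] (BiFree.rightV ![μ₁, μ₂] i) = 0) →
      (BiFree.convolution μ₁ μ₂ = BiFree.uniform ↔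
        BiFree.vacuumState ![μ₁, μ₂]
            (BiFree.leftU ![μ₁, μ₂] 0 * BiFree.rightV ![μ₁, μ₂] 0) = 0 ∨
          BiFree.vacuumState ![μ₁, μ₂]
            (BiFree.leftU ![μ₁, μ₂] 1 * BiFree.rightV ![μ₁, μ₂] 1) = 0)) ∧
    -- any two pairs of commuting unitaries in a C⋆-probability space, given by their distributions
    (∀ (A : Type*) [CStarAlgebra A] (φ : BiFree.State A) (u₁ v₁ u₂ v₂ : unitary A),
      Commute u₁ v₁ → Commute u₂ v₂ → φ u₁ = 0 → φ v₁ = 0 → φ u₂ = 0 → φ v₂ = 0 →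
      (BiFree.convolution (BiFree.distribution φ u₁ v₁) (BiFree.distribution φ u₂ v₂) =
          BiFree.uniform ↔ φ (u₁ * v₁) = 0 ∨ φ (u₂ * v₂) = 0)) ∧
    -- the uniform measure is absorbing
    (∀ (A : Type*) [CStarAlgebra A] (φ : BiFree.State A) (u v : unitary A),
      Commute u v → φ u = 0 → φ v = 0 →
      BiFree.convolution (BiFree.distribution φ u v) BiFree.uniform = BiFree.uniform ∧
        BiFree.convolution BiFree.uniform (BiFree.distribution φ u v) = BiFree.uniform) := by
  refine ⟨fun μ₁ μ₂ h => ?_, fun A _ φ u₁ v₁ u₂ v₂ hc₁ hc₂ hu₁ hv₁ hu₂ hv₂ => ?_,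
    fun A _ φ u v hc hu hv => ?_⟩
  · simp only [BiFree.vacuumState_leftU, BiFree.vacuumState_rightV] at h
    rw [BiFree.vacuumState_leftU_mul_rightV, BiFree.vacuumState_leftU_mul_rightV]
    exact BiFree.convolution_eq_uniform_iff μ₁ μ₂ (h 0).1 (h 0).2 (h 1).1 (h 1).2
  -- The moments of the two distributions are the values of `φ` on the pairs, so the criterion for
  -- measures applies directly.
  · rw [BiFree.convolution_eq_uniform_iff] <;>
      simp [BiFree.integral_distribution_torusMonomial φ hc₁,
        BiFree.integral_distribution_torusMonomial φ hc₂, *]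
  -- The uniform measure is itself centred with vanishing mixed moment, so one of the two
  -- alternatives always holds.
  · have h0 : ∀ {m n : ℤ}, m ≠ 0 ∨ n ≠ 0 →
        ∫ x, BiFree.torusMonomial m n x ∂(BiFree.uniform : MeasureTheory.Measure BiFree.Torus) =
          0 := BiFree.integral_uniform_torusMonomial
    have h1 := BiFree.integral_distribution_torusMonomial φ hc 1 0
    have h2 := BiFree.integral_distribution_torusMonomial φ hc 0 1
    rw [zpow_one, zpow_zero, mul_one, hu] at h1
    rw [zpow_one, zpow_zero, one_mul, hv] at h2
    exact ⟨(BiFree.convolution_eq_uniform_iff _ _ h1 h2 (h0 (by simp)) (h0 (by simp))).2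
        (Or.inr (h0 (by simp))),
      (BiFree.convolution_eq_uniform_iff _ _ (h0 (by simp)) (h0 (by simp)) h1 h2).2
        (Or.inl (h0 (by simp)))⟩
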